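/- Let $n$ be a positive integer and $K$ a field. Write $M_n(K)$ for the space of $n\times n$ matrices over $K$ and $GL_n(K)\subset M_n(K)$ for the set of non-singular matrices. An affine automorphism of $M_n(K)$ is a bijective affine map $M_n(K)\to M_n(K)$. Let $\mathcal{AG}_n(K)$ be the group, under composition, of the affine automorphisms $u$ of $M_n(K)$ with $u(GL_n(K))=GL_n(K)$. Let $\mathcal G_n(K)$ be the Frobenius group, which consists of all the linear automorphisms $M\mapsto PMQ$ and $M\mapsto PM^tQ$ of $M_n(K)$ with $P,Q\in GL_n(K)$. (a) If $n>2$ or $|K|>2$, then every affine automorphism $u$ of $M_n(K)$ with $u(GL_n(K))\subseteq GL_n(K)$ is linear and belongs to $\mathcal{AG}_n(K)$; moreover $\mathcal{AG}_n(K)=\mathcal G_n(K)$. (b) Not all elements of $\mathcal{AG}_2(\mathbb F_2)$ are linear maps. (c) Restricting each $u\in\mathcal{AG}_2(\mathbb F_2)$ to $GL_2(\mathbb F_2)$ gives a group isomorphism from $\mathcal{AG}_2(\mathbb F_2)$ onto the group $\mathfrak S(GL_2(\mathbb F_2))$ of all permutations of the set $GL_2(\mathbb F_2)$. This set has exactly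 $6$ elements, so $\mathfrak S(GL_2(\mathbb F_2))\cong\mathfrak S_6$. The form $b(A,B)=\det(A+B)-\det(A)-\det(B)$ on $M_2(\mathbb F_2)$ is bilinear, alternating and nondegenerate, and assigning to each $u\in\mathcal{AG}_2(\mathbb F_2)$ its linear part gives a group isomorphism from $\mathcal{AG}_2(\mathbb F_2)$ onto the symplectic group of $b$, i.e. the group of all linear automorphisms $f$ of $M_2(\mathbb F_2)$ with $b(f(A),f(B))=b(A,B)$ for all $A,B$. -/

import Mathlib

/-- The set of non-singular `n × n` matrices over `K`, inside the algebra of all matrices. -/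
def glSet (n : ℕ) (K : Type*) [Field K] : Set (Matrix (Fin n) (Fin n) K) :=
  {M | IsUnit M}

/-- The group of affine automorphisms (bijective affine maps, under composition) of the space
of `n × n` matrices that stabilize the set of non-singular matrices. -/
def affineStabilizer (n : ℕ) (K : Type*) [Field K] :
    Subgroup (Matrix (Fin n) (Fin n) K ≃ᵃ[K] Matrix (Fin n) (Fin n) K) where
  carrier := {u | u '' glSet n K = glSet n K}
  mul_mem' := by
    intro u v hu hv
    simp only [Set.mem_ofPred_eq] at hu hv ⊢
    rw [AffineEquiv.coe_mul, Set.image_comp, hv, hu]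
  one_mem' := by simp
  inv_mem' := by
    intro u hu
    simp only [Set.mem_ofPred_eq] at hu ⊢
    conv_lhs => rw [← hu]
    rw [← Set.image_comp, ← AffineEquiv.coe_mul, inv_mul_cancel]
    simp

/-- The linear automorphism `M ↦ P M Q`. -/
def frobeniusU {n : ℕ} {K : Type*} [Field K] (P Q : (Matrix (Fin n) (Fin n) K)ˣ) :
    Matrix (Fin n) (Fin n) K ≃ₗ[K] Matrix (Fin n) (Fin n) K where
  toFun M := (P : Matrix (Fin n) (Fin n) K) * M * (Q : Matrix (Fin n) (Fin n) K)
  map_add' A B := by rw [mul_add, add_mul]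
  map_smul' c A := by simp
  invFun M := ((P⁻¹ : (Matrix (Fin n) (Fin n) K)ˣ) : Matrix (Fin n) (Fin n) K) * M *
    ((Q⁻¹ : (Matrix (Fin n) (Fin n) K)ˣ) : Matrix (Fin n) (Fin n) K)
  left_inv M := by
    dsimp only
    rw [mul_assoc (P : Matrix (Fin n) (Fin n) K), Units.inv_mul_cancel_left,
      Units.mul_inv_cancel_right]
  right_inv M := by
    dsimp only
    rw [mul_assoc ((P⁻¹ : (Matrix (Fin n) (Fin n) K)ˣ) : Matrix (Fin n) (Fin n) K),
      Units.mul_inv_cancel_left, Units.inv_mul_cancel_right]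

/-- The linear automorphism `M ↦ P Mᵗ Q`. -/
def frobeniusV {n : ℕ} {K : Type*} [Field K] (P Q : (Matrix (Fin n) (Fin n) K)ˣ) :
    Matrix (Fin n) (Fin n) K ≃ₗ[K] Matrix (Fin n) (Fin n) K :=
  (Matrix.transposeLinearEquiv (Fin n) (Fin n) K K).trans (frobeniusU P Q)

theorem frobeniusU_apply {n : ℕ} {K : Type*} [Field K] (P Q : (Matrix (Fin n) (Fin n) K)ˣ)
    (M : Matrix (Fin n) (Fin n) K) :
    frobeniusU P Q M = (P : Matrix (Fin n) (Fin n) K) * M * (Q : Matrix (Fin n) (Fin n) K) := rfl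

theorem frobeniusV_apply {n : ℕ} {K : Type*} [Field K] (P Q : (Matrix (Fin n) (Fin n) K)ˣ)
    (M : Matrix (Fin n) (Fin n) K) :
    frobeniusV P Q M = (P : Matrix (Fin n) (Fin n) K) * M.transpose *
      (Q : Matrix (Fin n) (Fin n) K) := rfl

/-- The transpose of a non-singular matrix, as a non-singular matrix. -/
def unitTranspose {n : ℕ} {K : Type*} [Field K] (P : (Matrix (Fin n) (Fin n) K)ˣ) :
    (Matrix (Fin n) (Fin n) K)ˣ where
  val := (P : Matrix (Fin n) (Fin n) K).transpose
  inv := ((P⁻¹ : (Matrix (Fin n) (Fin n) K)ˣ) : Matrix (Fin n) (Fin n) K).transpose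
  val_inv := by rw [← Matrix.transpose_mul, Units.inv_mul, Matrix.transpose_one]
  inv_val := by rw [← Matrix.transpose_mul, Units.mul_inv, Matrix.transpose_one]

/-- The Frobenius group: all maps `M ↦ P M Q` and `M ↦ P Mᵗ Q` with `P`, `Q` non-singular. -/
def frobeniusGroup (n : ℕ) (K : Type*) [Field K] :
    Subgroup (Matrix (Fin n) (Fin n) K ≃ₗ[K] Matrix (Fin n) (Fin n) K) where
  carrier := {f | ∃ P Q : (Matrix (Fin n) (Fin n) K)ˣ, f = frobeniusU P Q} ∪
    {f | ∃ P Q : (Matrix (Fin n) (Fin n) K)ˣ, f = frobeniusV P Q}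
  mul_mem' := by
    rintro f g (⟨P, Q, rfl⟩ | ⟨P, Q, rfl⟩) (⟨R, S, rfl⟩ | ⟨R, S, rfl⟩)
    · refine Or.inl ⟨P * R, S * Q, LinearEquiv.ext fun M => ?_⟩
      simp [frobeniusU_apply, mul_assoc]
    · refine Or.inr ⟨P * R, S * Q, LinearEquiv.ext fun M => ?_⟩
      simp [frobeniusU_apply, frobeniusV_apply, mul_assoc]
    · refine Or.inr ⟨P * unitTranspose S, unitTranspose R * Q, LinearEquiv.ext fun M => ?_⟩
      simp [frobeniusU_apply, frobeniusV_apply, unitTranspose, mul_assoc]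
    · refine Or.inl ⟨P * unitTranspose S, unitTranspose R * Q, LinearEquiv.ext fun M => ?_⟩
      simp [frobeniusU_apply, frobeniusV_apply, unitTranspose, mul_assoc]
  one_mem' := Or.inl ⟨1, 1, LinearEquiv.ext fun M => by simp [frobeniusU_apply]⟩
  inv_mem' := by
    rintro f (⟨P, Q, rfl⟩ | ⟨P, Q, rfl⟩)
    · exact Or.inl ⟨P⁻¹, Q⁻¹, LinearEquiv.ext fun M => rfl⟩
    · refine Or.inr ⟨unitTranspose Q⁻¹, unitTranspose P⁻¹, inv_eq_of_mul_eq_one_right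
        (LinearEquiv.ext fun M => ?_)⟩
      simp [frobeniusV_apply, unitTranspose, mul_assoc]

/-- Linear automorphisms regarded as affine automorphisms. -/
def linearToAffine (K V : Type*) [Field K] [AddCommGroup V] [Module K V] :
    (V ≃ₗ[K] V) →* (V ≃ᵃ[K] V) where
  toFun f := f.toAffineEquiv
  map_one' := by ext; rfl
  map_mul' _ _ := by ext; rfl

/-- The polar form `(A, B) ↦ det (A + B) - det A - det B` of the determinant on `2 × 2` matrices
over the field with two elements. -/
def detPolarForm : LinearMap.BilinForm (ZMod 2) (Matrix (Fin 2) (Fin 2) (ZMod 2)) :=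
  LinearMap.mk₂ (ZMod 2) (fun A B => (A + B).det - A.det - B.det)
    (by intro A B C; simp only [Matrix.det_fin_two, Matrix.add_apply]; ring)
    (by intro c A B; simp only [Matrix.det_fin_two, Matrix.add_apply, Matrix.smul_apply,
          smul_eq_mul]; ring)
    (by intro A B C; simp only [Matrix.det_fin_two, Matrix.add_apply]; ring)
    (by intro c A B; simp only [Matrix.det_fin_two, Matrix.add_apply, Matrix.smul_apply,
          smul_eq_mul]; ring)

/-- The group of linear automorphisms preserving a bilinear form; this is the symplectic group
of the form when the form is alternating and nondegenerate. -/
def formGroup {K V : Type*} [Field K] [AddCommGroup V] [Module K V]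
    (b : LinearMap.BilinForm K V) : Subgroup (V ≃ₗ[K] V) where
  carrier := {f | ∀ x y, b (f x) (f y) = b x y}
  mul_mem' := by
    intro f g hf hg x y
    exact (hf (g x) (g y)).trans (hg x y)
  one_mem' := fun _ _ => rfl
  inv_mem' := by
    intro f hf x y
    have h := hf (f⁻¹ x) (f⁻¹ y)
    have e : ∀ z, f (f⁻¹ z) = z := fun z => f.apply_symm_apply z
    rw [e, e] at h
    exact h.symm

/-! For (a), the inverse of `u` sends singular matrices to singular matrices; write it as `M ↦ w M +
b`. Once `w` lies in the Frobenius group, it preserves singularity in both directions, so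
translation by `b` preserves singular matrices and `b = 0` (`eq_zero_of_translation`). A linear
automorphism that preserves dyads is in the Frobenius group (`mem_frobeniusGroup_of_isDyad`): linear
spaces of dyads share a column or a row, and the two types cannot mix. It remains to produce dyads.

Over an infinite field, interpolation at known roots gives `det (w M) = c * det M`
(`det_linear_eq_mul_det`). The determinant is affine along a dyad, and along no direction of larger
rank at every base point, so `w` preserves dyads (`isDyad_of_det_eq_mul_det`).

Over a finite field with `q` elements, the affine map permutes the singular matrices. The trace
adjoint of `w` therefore preserves the absolute values of the Fourier coefficients of the indicator
of `GL_n`. These are strictly larger at rank one than at higher rank as soon as `q ^ (n - 1) > 2`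
(`norm_glCharSum_lt`), so the adjoint preserves dyads, and `w` follows its adjoint into the
Frobenius group.

Over `𝔽₂` with `n = 2`, stabilizing `GL` means preserving the quadratic form `det`. Affine
corrections of orthogonal transvections realize all transpositions of the six non-singular matrices,
which affinely span the space. For a symplectic `f`, the defect `det ∘ f + det` is additive, hence
represented by the form, and a translation absorbs it (`linearPart_bijective`). -/

open Matrix

/-! ### Dyads and the linear automorphisms that preserve them -/

/-- Matrices of rank at most one, written as a product of a column and a row. -/
def IsDyad {n : ℕ} {K : Type*} [Field K] (M : Matrix (Fin n) (Fin n) K) : Prop :=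
  ∃ x y, M = vecMulVec x y

theorem IsDyad.transpose {n : ℕ} {K : Type*} [Field K] {M : Matrix (Fin n) (Fin n) K}
    (h : IsDyad M) : IsDyad M.transpose := by
  obtain ⟨x, y, rfl⟩ := h
  exact ⟨y, x, transpose_vecMulVec x y⟩

theorem IsDyad.mul_mul {n : ℕ} {K : Type*} [Field K] {M : Matrix (Fin n) (Fin n) K}
    (h : IsDyad M) (P Q : Matrix (Fin n) (Fin n) K) : IsDyad (P * M * Q) := by
  obtain ⟨x, y, rfl⟩ := h
  exact ⟨P *ᵥ x, y ᵥ* Q, by rw [mul_vecMulVec, vecMulVec_mul]⟩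

theorem IsDyad.minor {n : ℕ} {K : Type*} [Field K] {M : Matrix (Fin n) (Fin n) K}
    (h : IsDyad M) (i j k l : Fin n) : M i j * M k l = M i l * M k j := by
  obtain ⟨x, y, rfl⟩ := h
  simp only [vecMulVec_apply]; ring

/-- If the sum of two dyads is a dyad, then they share their column or their row, up to
scalars. -/
theorem exists_smul_of_isDyad_add {n : ℕ} {K : Type*} [Field K] {a b c d : Fin n → K}
    (ha : a ≠ 0) (hb : b ≠ 0) (h : IsDyad (vecMulVec a b + vecMulVec c d)) :
    (∃ r : K, c = r • a) ∨ ∃ r : K, d = r • b := by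
  obtain ⟨i, hi⟩ := Function.ne_iff.1 ha
  obtain ⟨j, hj⟩ := Function.ne_iff.1 hb
  simp only [Pi.zero_apply] at hi hj
  by_cases hc : ∀ k, a i * c k = a k * c i
  · left
    refine ⟨c i / a i, funext fun k => ?_⟩
    simp only [Pi.smul_apply, smul_eq_mul]
    field_simp
    linear_combination hc k
  · right
    push Not at hc
    obtain ⟨k, hk⟩ := hc
    refine ⟨d j / b j, funext fun l => ?_⟩
    simp only [Pi.smul_apply, smul_eq_mul]
    have e := h.minor i j k l
    simp only [Matrix.add_apply, vecMulVec_apply] at e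
    -- A 2 × 2 minor of a sum of two dyads is the product of a minor of the columns and a minor of
    -- the rows.
    have e2 : (a i * c k - a k * c i) * (b j * d l - b l * d j) = 0 := by
      linear_combination e
    have e3 := (mul_eq_zero.1 e2).resolve_left (sub_ne_zero.2 hk)
    field_simp
    linear_combination e3

/-- A coordinate where `a` does not vanish recovers the row by division, so the row depends linearly
on `y`. -/
theorem exists_linear_row {n : ℕ} {K V : Type*} [Field K] [AddCommGroup V] [Module K V]
    (φ : V →ₗ[K] Matrix (Fin n) (Fin n) K) {a : Fin n → K} (ha : a ≠ 0)
    (h : ∀ y, ∃ b, φ y = vecMulVec a b) :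
    ∃ g : V →ₗ[K] (Fin n → K), ∀ y, φ y = vecMulVec a (g y) := by
  obtain ⟨i, hi⟩ := Function.ne_iff.1 ha
  simp only [Pi.zero_apply] at hi
  refine ⟨{ toFun := fun y l => φ y i l / a i, map_add' := ?_, map_smul' := ?_ }, fun y => ?_⟩
  · intro x y; ext l; simp [add_div]
  · intro c y; ext l; simp [mul_div_assoc]
  · obtain ⟨b, hb⟩ := h y
    ext k l
    simp only [LinearMap.coe_mk, AddHom.coe_mk, vecMulVec_apply, hb]
    field_simp

theorem exists_linear_col {n : ℕ} {K V : Type*} [Field K] [AddCommGroup V] [Module K V]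
    (φ : V →ₗ[K] Matrix (Fin n) (Fin n) K) {b : Fin n → K} (hb : b ≠ 0)
    (h : ∀ y, ∃ a, φ y = vecMulVec a b) :
    ∃ g : V →ₗ[K] (Fin n → K), ∀ y, φ y = vecMulVec (g y) b := by
  obtain ⟨g, hg⟩ := exists_linear_row
    ((transposeLinearEquiv (Fin n) (Fin n) K K).toLinearMap ∘ₗ φ) hb (fun y => by
      obtain ⟨a, e⟩ := h y
      exact ⟨a, by simp [e, transpose_vecMulVec]⟩)
  refine ⟨g, fun y => ?_⟩
  have := congrArg Matrix.transpose (hg y)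
  simpa [transpose_vecMulVec] using this

/-- A linear space of dyads has a common column or a common row. -/
theorem common_col_or_row {n : ℕ} {K V : Type*} [Field K] [AddCommGroup V] [Module K V]
    [Nontrivial V] (φ : V →ₗ[K] Matrix (Fin n) (Fin n) K) (hφ : Function.Injective φ)
    (h : ∀ y, IsDyad (φ y)) :
    (∃ a ≠ 0, ∃ g : V →ₗ[K] (Fin n → K), ∀ y, φ y = vecMulVec a (g y)) ∨
    (∃ b ≠ 0, ∃ g : V →ₗ[K] (Fin n → K), ∀ y, φ y = vecMulVec (g y) b) := by
  -- A zero dyad may have a nonzero factor; both factors are forced to vanish at `y = 0` so that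
  -- proportionality also holds there.
  have h' : ∀ y, ∃ a b, φ y = vecMulVec a b ∧ (y = 0 → a = 0 ∧ b = 0) := by
    intro y
    by_cases hy : y = 0
    · exact ⟨0, 0, by simp [hy], fun _ => ⟨rfl, rfl⟩⟩
    · obtain ⟨a, b, e⟩ := h y
      exact ⟨a, b, e, fun h => absurd h hy⟩
  choose a b hab hzero using h'
  have ne : ∀ y, y ≠ 0 → a y ≠ 0 ∧ b y ≠ 0 := by
    intro y hy
    have : φ y ≠ 0 := fun e => hy (hφ (by rw [e, map_zero]))
    rw [hab] at this
    rwa [Ne, vecMulVec_eq_zero, not_or] at this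
  have key : ∀ y z, y ≠ 0 → (∃ r : K, a z = r • a y) ∨ ∃ r : K, b z = r • b y := by
    intro y z hy
    exact exists_smul_of_isDyad_add (ne y hy).1 (ne y hy).2
      ⟨a (y + z), b (y + z), by rw [← hab, ← hab, ← hab, map_add]⟩
  obtain ⟨y₀, hy₀⟩ := exists_ne (0 : V)
  by_cases H : ∀ y, ∃ r : K, a y = r • a y₀
  · left
    refine ⟨a y₀, (ne _ hy₀).1, exists_linear_row φ (ne _ hy₀).1 fun y => ?_⟩
    obtain ⟨r, hr⟩ := H y
    exact ⟨r • b y, by rw [hab, hr, smul_vecMulVec, vecMulVec_smul]⟩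
  · right
    push Not at H
    obtain ⟨y₁, hy₁⟩ := H
    have h10 : ∃ r : K, b y₁ = r • b y₀ := (key y₀ y₁ hy₀).resolve_left (by simpa using hy₁)
    obtain ⟨s, hs⟩ := h10
    have hy10 : y₁ ≠ 0 := by
      rintro rfl
      exact hy₁ 0 (by rw [(hzero 0 rfl).1, zero_smul])
    have H2 : ∀ y, ∃ r : K, b y = r • b y₀ := by
      intro y
      by_cases hy : y = 0
      · exact ⟨0, by rw [(hzero y hy).2, zero_smul]⟩
      rcases key y₀ y hy₀ with ⟨r, hr⟩ | h
      · rcases key y₁ y hy10 with ⟨t, ht⟩ | ⟨t, ht⟩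
        · exfalso
          have t0 : t ≠ 0 := by rintro rfl; exact (ne y hy).1 (by simpa using ht)
          refine hy₁ (t⁻¹ * r) ?_
          rw [mul_smul, ← hr, ht, smul_smul, inv_mul_cancel₀ t0, one_smul]
        · exact ⟨t * s, by rw [ht, hs, smul_smul]⟩
      · exact h
    refine ⟨b y₀, (ne _ hy₀).2, exists_linear_col φ (ne _ hy₀).2 fun y => ?_⟩
    obtain ⟨r, hr⟩ := H2 y
    exact ⟨r • a y, by rw [hab, hr, smul_vecMulVec, vecMulVec_smul]⟩

theorem exists_not_mem_span {n : ℕ} {K : Type*} [Field K] (hn : 2 ≤ n) (a : Fin n → K) :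
    ∃ z : Fin n → K, ∀ r : K, z ≠ r • a := by
  by_contra! H
  have : Module.finrank K (Fin n → K) ≤ 1 := finrank_le_one a fun w => by
    obtain ⟨r, hr⟩ := H w
    exact ⟨r, hr.symm⟩
  rw [Module.finrank_fin_fun] at this
  omega

/-- A column pencil and a row pencil of dyads cannot be added to a space of dyads. -/
theorem not_col_and_row {n : ℕ} {K : Type*} [Field K] (hn : 2 ≤ n) {a b : Fin n → K}
    (ha : a ≠ 0) (hb : b ≠ 0) {g h : (Fin n → K) →ₗ[K] (Fin n → K)}
    (hg : Function.Injective g) (hh : Function.Injective h)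
    (H : ∀ y, IsDyad (vecMulVec a (g y) + vecMulVec (h y) b)) : False := by
  have hg' := LinearMap.injective_iff_surjective.1 hg
  have hh' := LinearMap.injective_iff_surjective.1 hh
  have key : ∀ y, (∃ r : K, h y = r • a) ∨ ∃ r : K, g y = r • b := by
    intro y
    by_cases hy : y = 0
    · exact Or.inl ⟨0, by simp [hy]⟩
    have hgy : g y ≠ 0 := fun e => hy (hg (by rw [e, map_zero]))
    refine (exists_smul_of_isDyad_add ha hgy (H y)).imp id ?_
    rintro ⟨r, hr⟩
    have r0 : r ≠ 0 := by rintro rfl; exact hb (by simpa using hr)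
    exact ⟨r⁻¹, by rw [hr, smul_smul, inv_mul_cancel₀ r0, one_smul]⟩
  obtain ⟨z, hz⟩ := exists_not_mem_span hn a
  obtain ⟨z', hz'⟩ := exists_not_mem_span hn b
  obtain ⟨y, rfl⟩ := hh' z
  obtain ⟨y', rfl⟩ := hg' z'
  obtain ⟨r, hr⟩ := (key y).resolve_left fun ⟨r, hr⟩ => hz r hr
  obtain ⟨s, hs⟩ := (key y').resolve_right fun ⟨r, hr⟩ => hz' r hr
  -- `y` escapes the column line and `y'` the row line, each lying on the other line, so `y + y'`
  -- escapes both.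
  rcases key (y + y') with ⟨t, ht⟩ | ⟨t, ht⟩
  · refine hz (t - s) ?_
    rw [sub_smul, ← ht, ← hs, map_add, add_sub_cancel_right]
  · refine hz' (t - r) ?_
    rw [sub_smul, ← ht, ← hr, map_add, add_sub_cancel_left]

/-- After composition with the inverse of `g`, every vector is an eigenvector, so the map is a
homothety. -/
theorem exists_eq_smul_of_forall {n : ℕ} {K : Type*} [Field K]
    {g g' : (Fin n → K) →ₗ[K] (Fin n → K)} (hg : Function.Injective g)
    (h : ∀ y, ∃ r : K, g' y = r • g y) : ∃ r : K, g' = r • g := by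
  let e := LinearEquiv.ofInjectiveEndo g hg
  have he : ∀ y, e y = g y := fun _ => rfl
  obtain ⟨r, hr⟩ := LinearMap.exists_eq_smul_id_of_forall_notLinearIndependent
    (f := e.symm.toLinearMap ∘ₗ g') (fun v hv => by
      obtain ⟨r, hr⟩ := h v
      have := LinearIndependent.pair_iff.1 hv r (-1) (by
        simp [hr, ← he])
      exact one_ne_zero (neg_eq_zero.1 this.2))
  refine ⟨r, LinearMap.ext fun y => ?_⟩
  have := congrArg e (LinearMap.congr_fun hr y)
  rw [LinearMap.comp_apply, LinearEquiv.coe_coe, e.apply_symm_apply] at this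
  simpa [he] using this

theorem ext_vecMulVec {n : ℕ} {K V : Type*} [Field K] [AddCommGroup V] [Module K V]
    {f g : Matrix (Fin n) (Fin n) K →ₗ[K] V}
    (h : ∀ x y, f (vecMulVec x y) = g (vecMulVec x y)) : f = g := by
  refine Matrix.ext_linearMap K fun i j => LinearMap.ext_ring ?_
  simp only [LinearMap.comp_apply, singleLinearMap_apply]
  rw [single_eq_single_vecMulVec_single, h]

/-- A linear automorphism `M ↦ P M Q` has non-singular coefficients `P` and `Q`. -/
theorem exists_frobeniusU {n : ℕ} {K : Type*} [Field K]
    (w : Matrix (Fin n) (Fin n) K ≃ₗ[K] Matrix (Fin n) (Fin n) K)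
    (P Q : Matrix (Fin n) (Fin n) K) (h : ∀ M, w M = P * M * Q) :
    ∃ P Q : (Matrix (Fin n) (Fin n) K)ˣ, w = frobeniusU P Q := by
  obtain ⟨M, hM⟩ := w.surjective 1
  rw [h] at hM
  have hd := congrArg det hM
  rw [det_mul, det_mul, det_one] at hd
  have hP : IsUnit P := (isUnit_iff_isUnit_det P).2
    (isUnit_iff_ne_zero.2 fun e => by simp [e] at hd)
  have hQ : IsUnit Q := (isUnit_iff_isUnit_det Q).2
    (isUnit_iff_ne_zero.2 fun e => by simp [e] at hd)
  obtain ⟨P, rfl⟩ := hP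
  obtain ⟨Q, rfl⟩ := hQ
  exact ⟨P, Q, LinearEquiv.ext h⟩

/-- A linear automorphism mapping every pencil of dyads with a common column to a pencil with
a common column has the form `M ↦ P M Q`. -/
theorem exists_frobeniusU_of_col {n : ℕ} {K : Type*} [Field K] (hn : 2 ≤ n)
    (w : Matrix (Fin n) (Fin n) K ≃ₗ[K] Matrix (Fin n) (Fin n) K)
    (hw : ∀ M, IsDyad M → IsDyad (w M))
    (hC : ∀ x : Fin n → K, x ≠ 0 → ∃ a ≠ 0, ∃ g : (Fin n → K) →ₗ[K] (Fin n → K),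
      ∀ y, w (vecMulVec x y) = vecMulVec a (g y)) :
    ∃ P Q : (Matrix (Fin n) (Fin n) K)ˣ, w = frobeniusU P Q := by
  have hC' : ∀ x : Fin n → K, ∃ a, ∃ g : (Fin n → K) →ₗ[K] (Fin n → K),
      (x = 0 → a = 0 ∧ g = 0) ∧ (x ≠ 0 → a ≠ 0) ∧ (x ≠ 0 → Function.Injective g) ∧
      ∀ y, w (vecMulVec x y) = vecMulVec a (g y) := by
    intro x
    by_cases hx : x = 0
    · exact ⟨0, 0, by simp, by simp [hx], by simp [hx], by simp [hx]⟩
    · obtain ⟨a, ha, g, h⟩ := hC x hx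
      refine ⟨a, g, fun h => absurd h hx, fun _ => ha, fun _ => ?_, h⟩
      refine (injective_iff_map_eq_zero g).2 fun y hy => ?_
      have := h y
      rw [hy, vecMulVec_zero, map_eq_zero_iff _ w.injective, vecMulVec_eq_zero] at this
      exact this.resolve_left hx
  choose a g h0 ha hg hag using hC'
  have step : ∀ x x', x ≠ 0 → (∀ r : K, a x' ≠ r • a x) → ∃ r : K, g x' = r • g x := by
    intro x x' hx hn'
    refine exists_eq_smul_of_forall (hg x hx) fun y => ?_
    by_cases hy : y = 0
    · exact ⟨0, by simp [hy]⟩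
    have hgy : g x y ≠ 0 := fun e => hy (hg x hx (by rw [e, map_zero]))
    refine (exists_smul_of_isDyad_add (ha x hx) hgy ?_).resolve_left fun ⟨r, hr⟩ => hn' r hr
    rw [← hag, ← hag, ← map_add, ← add_vecMulVec]
    exact hw _ ⟨_, _, rfl⟩
  have : NeZero n := ⟨by omega⟩
  have : Nontrivial (Fin n) := Fin.nontrivial_iff_two_le.2 hn
  obtain ⟨x₀, hx₀⟩ := exists_ne (0 : Fin n → K)
  obtain ⟨x₁, hx₁⟩ : ∃ x₁, ∀ r : K, a x₁ ≠ r • a x₀ := by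
    by_contra! H
    obtain ⟨i, hi⟩ := Function.ne_iff.1 (ha x₀ hx₀)
    simp only [Pi.zero_apply] at hi
    obtain ⟨j, hj⟩ := exists_ne i
    -- If all columns were proportional to `a x₀`, the image of `w` would satisfy this linear
    -- relation, which the matrix unit at `(j, j)` violates.
    let f : Matrix (Fin n) (Fin n) K →ₗ[K] K :=
      { toFun := fun M => a x₀ j * w M i j - a x₀ i * w M j j
        map_add' := fun A B => by simp; ring
        map_smul' := fun c A => by simp; ring }
    have hf : f = 0 := ext_vecMulVec fun x y => by
      obtain ⟨r, hr⟩ := H x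
      simp only [f, LinearMap.coe_mk, AddHom.coe_mk, hag, hr, vecMulVec_apply, Pi.smul_apply,
        smul_eq_mul, LinearMap.zero_apply]
      ring
    obtain ⟨M, hM⟩ := w.surjective (Matrix.single j j 1)
    have := LinearMap.congr_fun hf M
    simp [f, hM, hj] at this
    exact hi this
  have hx₁0 : x₁ ≠ 0 := by
    rintro rfl
    exact hx₁ 0 (by rw [(h0 0 rfl).1, zero_smul])
  have prop : ∀ x, ∃ r : K, g x = r • g x₀ := by
    intro x
    by_cases h : ∀ r : K, a x ≠ r • a x₀
    · exact step x₀ x hx₀ h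
    · push Not at h
      obtain ⟨r, hr⟩ := h
      obtain ⟨t, ht⟩ := step x₀ x₁ hx₀ hx₁
      by_cases hx : x = 0
      · exact ⟨0, by rw [(h0 x hx).2, zero_smul]⟩
      -- A column on the line of `a x₀` is off the line of `a x₁`, so the comparison of rows goes
      -- through `x₁`.
      obtain ⟨s, hs⟩ := step x₁ x hx₁0 fun s hs => by
        have s0 : s ≠ 0 := by rintro rfl; exact ha x hx (by rw [hs, zero_smul])
        refine hx₁ (s⁻¹ * r) ?_
        rw [mul_smul, ← hr, hs, smul_smul, inv_mul_cancel₀ s0, one_smul]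
      exact ⟨s * t, by rw [hs, ht, smul_smul]⟩
  have pure : ∀ x, ∃ c, ∀ y, w (vecMulVec x y) = vecMulVec c (g x₀ y) := by
    intro x
    obtain ⟨r, hr⟩ := prop x
    exact ⟨r • a x, fun y => by
      rw [hag, hr, LinearMap.smul_apply, smul_vecMulVec, vecMulVec_smul]⟩
  obtain ⟨y₀, hy₀⟩ := exists_ne (0 : Fin n → K)
  have hgy₀ : g x₀ y₀ ≠ 0 := fun e => hy₀ (hg x₀ hx₀ (by rw [e, map_zero]))
  obtain ⟨p, hp⟩ := exists_linear_col
    (w.toLinearMap ∘ₗ (vecMulVecBilin K K).flip y₀) hgy₀ (fun x => by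
      obtain ⟨c, hc⟩ := pure x
      exact ⟨c, by simpa using hc y₀⟩)
  have final : ∀ x y, w (vecMulVec x y) = vecMulVec (p x) (g x₀ y) := by
    intro x y
    obtain ⟨c, hc⟩ := pure x
    have hpx := hp x
    simp only [LinearMap.comp_apply, LinearMap.flip_apply, LinearEquiv.coe_coe] at hpx
    have h1 : vecMulVec (c - p x) (g x₀ y₀) = 0 := by
      rw [sub_vecMulVec, ← hc, ← hpx]; simp
    rw [vecMulVec_eq_zero] at h1
    rw [hc, sub_eq_zero.1 (h1.resolve_right hgy₀)]
  refine exists_frobeniusU w (LinearMap.toMatrix' p) (LinearMap.toMatrix' (g x₀)).transpose ?_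
  have hL : w.toLinearMap = LinearMap.mulRight K (LinearMap.toMatrix' (g x₀)).transpose ∘ₗ
      LinearMap.mulLeft K (LinearMap.toMatrix' p) := ext_vecMulVec fun x y => by
    simp only [LinearEquiv.coe_coe, LinearMap.comp_apply, LinearMap.mulLeft_apply,
      LinearMap.mulRight_apply, final]
    rw [mul_vecMulVec, vecMulVec_mul, vecMul_transpose, LinearMap.toMatrix'_mulVec,
      LinearMap.toMatrix'_mulVec]
  exact fun M => LinearMap.congr_fun hL M

/-- A linear automorphism of the space of matrices that maps dyads to dyads belongs to the
Frobenius group. -/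
theorem mem_frobeniusGroup_of_isDyad {n : ℕ} {K : Type*} [Field K]
    (w : Matrix (Fin n) (Fin n) K ≃ₗ[K] Matrix (Fin n) (Fin n) K)
    (hw : ∀ M, IsDyad M → IsDyad (w M)) : w ∈ frobeniusGroup n K := by
  rcases Nat.lt_or_ge n 2 with hn | hn
  · have : Subsingleton (Fin n) := Fin.subsingleton_iff_le_one.2 (by omega)
    refine Or.inl (exists_frobeniusU w (w 1) 1 fun M => ?_)
    have hM : M = M.trace • 1 := by
      ext i j
      obtain rfl := Subsingleton.elim i j
      simp [Matrix.trace, Fintype.sum_subsingleton _ i]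
    conv_lhs => rw [hM]
    conv_rhs => rw [hM]
    simp
  have : NeZero n := ⟨by omega⟩
  let B := vecMulVecBilin (m := Fin n) (n := Fin n) (A := K) K K
  have hB : ∀ x y, B x y = vecMulVec x y := fun _ _ => rfl
  have inj : ∀ x, x ≠ 0 → Function.Injective (w.toLinearMap ∘ₗ B x) := fun x hx => by
    refine (injective_iff_map_eq_zero _).2 fun y hy => ?_
    simp only [LinearMap.comp_apply, LinearEquiv.coe_coe, hB] at hy
    rw [map_eq_zero_iff _ w.injective, vecMulVec_eq_zero] at hy
    exact hy.resolve_left hx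
  have dich := fun x (hx : x ≠ 0) => common_col_or_row (w.toLinearMap ∘ₗ B x) (inj x hx)
    fun y => hw _ ⟨_, _, rfl⟩
  simp only [LinearMap.comp_apply, LinearEquiv.coe_coe, hB] at dich
  by_cases hC : ∀ x : Fin n → K, x ≠ 0 → ∃ a ≠ 0, ∃ g : (Fin n → K) →ₗ[K] (Fin n → K),
      ∀ y, w (vecMulVec x y) = vecMulVec a (g y)
  · exact Or.inl (exists_frobeniusU_of_col hn w hw hC)
  push Not at hC
  obtain ⟨x₁, hx₁, hC⟩ := hC
  obtain ⟨b, hb, h, hbh⟩ := (dich x₁ hx₁).resolve_left (by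
    rintro ⟨a, ha, g, hg⟩
    obtain ⟨y, hy⟩ := hC a ha g
    exact hy (hg y))
  have hR : ∀ x : Fin n → K, x ≠ 0 → ∃ b ≠ 0, ∃ g : (Fin n → K) →ₗ[K] (Fin n → K),
      ∀ y, w (vecMulVec x y) = vecMulVec (g y) b := by
    intro x hx
    refine (dich x hx).resolve_left ?_
    rintro ⟨a, ha, g, hg⟩
    refine not_col_and_row hn ha hb (g := g) (h := h) ?_ ?_ ?_
    · refine (injective_iff_map_eq_zero g).2 fun y hy => inj x hx ?_
      simp [hB, hg, hy]
    · refine (injective_iff_map_eq_zero h).2 fun y hy => inj x₁ hx₁ ?_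
      simp [hB, hbh, hy]
    · intro y
      rw [← hg, ← hbh, ← map_add, ← add_vecMulVec]
      exact hw _ ⟨_, _, rfl⟩
  -- All pencils go to row pencils here; transposing the values reduces to the column case.
  obtain ⟨P, Q, hPQ⟩ := exists_frobeniusU_of_col hn
    (w.trans (transposeLinearEquiv (Fin n) (Fin n) K K)) (fun M hM => (hw M hM).transpose)
    (fun x hx => by
      obtain ⟨b, hb, g, hg⟩ := hR x hx
      exact ⟨b, hb, g, fun y => by simp [hg, transpose_vecMulVec]⟩)
  refine Or.inr ⟨unitTranspose Q, unitTranspose P, LinearEquiv.ext fun M => ?_⟩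
  have := congrArg Matrix.transpose (LinearEquiv.congr_fun hPQ M)
  simpa [frobeniusU_apply, frobeniusV_apply, unitTranspose, Matrix.mul_assoc] using this

/-! ### Diagonal reduction and the determinant along a line -/

theorem exists_units_diagonal {n : ℕ} {K : Type*} [Field K] (M : Matrix (Fin n) (Fin n) K) :
    ∃ (P Q : (Matrix (Fin n) (Fin n) K)ˣ) (d : Fin n → K),
      M = (P : Matrix (Fin n) (Fin n) K) * diagonal d * (Q : Matrix (Fin n) (Fin n) K) := by
  obtain ⟨L, L', D, h⟩ := Pivot.exists_list_transvec_mul_diagonal_mul_list_transvec M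
  have hu : ∀ L : List (TransvectionStruct (Fin n) K),
      IsUnit (L.map TransvectionStruct.toMatrix).prod := fun L =>
    (isUnit_iff_isUnit_det _).2 (by simp)
  obtain ⟨P, hP⟩ := hu L
  obtain ⟨Q, hQ⟩ := hu L'
  exact ⟨P, Q, D, by rw [hP, hQ, h]⟩

theorem diagonal_single_isDyad {n : ℕ} {K : Type*} [Field K] (i : Fin n) (c : K) :
    IsDyad (diagonal (Pi.single i c)) := by
  refine ⟨Pi.single i c, Pi.single i 1, ?_⟩
  ext k l
  by_cases hk : k = i
  · subst hk
    by_cases hl : k = l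
    · subst hl; simp [vecMulVec_apply]
    · simp [vecMulVec_apply, hl, Ne.symm hl]
  · by_cases hl : k = l
    · subst hl; simp [vecMulVec_apply, hk]
    · simp [vecMulVec_apply, hk, hl]

theorem eq_single_of_mul_eq_zero {n : ℕ} {K : Type*} [Field K] {d : Fin n → K}
    (hd : ∀ i j, i ≠ j → d i * d j = 0) : d = 0 ∨ ∃ i, d i ≠ 0 ∧ d = Pi.single i (d i) := by
  by_cases h : d = 0
  · exact Or.inl h
  · obtain ⟨i, hi⟩ := Function.ne_iff.1 h
    refine Or.inr ⟨i, hi, funext fun j => ?_⟩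
    by_cases hj : j = i
    · subst hj; simp
    · rw [Pi.single_eq_of_ne hj]
      exact (mul_eq_zero.1 (hd j i hj)).resolve_right hi

theorem exists_diagonal_of_not_isDyad {n : ℕ} {K : Type*} [Field K]
    {M : Matrix (Fin n) (Fin n) K} (hM : ¬ IsDyad M) :
    ∃ (P Q : (Matrix (Fin n) (Fin n) K)ˣ) (d : Fin n → K) (i j : Fin n),
      M = (P : Matrix (Fin n) (Fin n) K) * diagonal d * (Q : Matrix (Fin n) (Fin n) K) ∧
      i ≠ j ∧ d i ≠ 0 ∧ d j ≠ 0 := by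
  obtain ⟨P, Q, d, h⟩ := exists_units_diagonal M
  by_contra! H
  refine hM ?_
  rcases eq_single_of_mul_eq_zero (d := d) (fun i j hij => by
    by_cases hi : d i = 0
    · simp [hi]
    · simp [H P Q d i j h hij hi]) with rfl | ⟨i, -, hd⟩
  · exact ⟨0, 0, by simp [h]⟩
  · rw [h, hd]
    exact (diagonal_single_isDyad i _).mul_mul _ _

theorem exists_single_of_isDyad {n : ℕ} {K : Type*} [Field K]
    {M : Matrix (Fin n) (Fin n) K} (hM : IsDyad M) (hM0 : M ≠ 0) :
    ∃ (P Q : (Matrix (Fin n) (Fin n) K)ˣ) (i : Fin n) (c : K), c ≠ 0 ∧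
      M = (P : Matrix (Fin n) (Fin n) K) * diagonal (Pi.single i c) *
        (Q : Matrix (Fin n) (Fin n) K) := by
  obtain ⟨P, Q, d, h⟩ := exists_units_diagonal M
  have hd : IsDyad (diagonal d) := by
    have := hM.mul_mul ((P⁻¹ : (Matrix (Fin n) (Fin n) K)ˣ) : Matrix (Fin n) (Fin n) K)
      ((Q⁻¹ : (Matrix (Fin n) (Fin n) K)ˣ) : Matrix (Fin n) (Fin n) K)
    rwa [h, Matrix.mul_assoc (P : Matrix (Fin n) (Fin n) K), Units.inv_mul_cancel_left,
      Units.mul_inv_cancel_right] at this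
  rcases eq_single_of_mul_eq_zero (d := d) (fun i j hij => by
    have := hd.minor i i j j
    simpa [hij] using this) with rfl | ⟨i, hi, hd⟩
  · exact absurd (by simp [h]) hM0
  · exact ⟨P, Q, i, d i, hi, by rw [← hd]; exact h⟩

/-- The determinant is affine in the direction of a dyad. -/
theorem det_add_smul_isDyad {n : ℕ} {K : Type*} [Field K] {A : Matrix (Fin n) (Fin n) K}
    (hA : IsDyad A) (B : Matrix (Fin n) (Fin n) K) :
    ∃ α β : K, ∀ t : K, (B + t • A).det = α + t * β := by
  by_cases h0 : A = 0
  · exact ⟨B.det, 0, by simp [h0]⟩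
  obtain ⟨P, Q, i, c, -, rfl⟩ := exists_single_of_isDyad hA h0
  set P' := (P : Matrix (Fin n) (Fin n) K)
  set Q' := (Q : Matrix (Fin n) (Fin n) K)
  set N := ((P⁻¹ : (Matrix (Fin n) (Fin n) K)ˣ) : Matrix (Fin n) (Fin n) K) * B *
    ((Q⁻¹ : (Matrix (Fin n) (Fin n) K)ˣ) : Matrix (Fin n) (Fin n) K)
  have hB : B = P' * N * Q' := by
    simp only [N, P', Q']
    rw [Matrix.mul_assoc _ B, Units.mul_inv_cancel_left, Units.inv_mul_cancel_right]
  refine ⟨P'.det * N.det * Q'.det, P'.det * (N.updateRow i (Pi.single i c)).det * Q'.det,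
    fun t => ?_⟩
  have e : B + t • (P' * diagonal (Pi.single i c) * Q') =
      P' * N.updateRow i (N i + t • Pi.single i c) * Q' := by
    have : N.updateRow i (N i + t • Pi.single i c) = N + t • diagonal (Pi.single i c) := by
      ext k l
      by_cases hk : k = i
      · subst hk
        by_cases hl : k = l
        · subst hl; simp
        · simp [hl, Ne.symm hl]
      · by_cases hl : k = l
        · subst hl; simp [hk]
        · simp [hk, hl]
    rw [this, hB, Matrix.mul_add, Matrix.add_mul, Matrix.mul_smul, Matrix.smul_mul]
  rw [e, det_mul, det_mul, det_updateRow_add, det_updateRow_smul, updateRow_eq_self]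
  ring

theorem eval_det_X_smul_add {n : ℕ} {K : Type*} [Field K] (A B : Matrix (Fin n) (Fin n) K)
    (t : K) : Polynomial.eval t (det ((Polynomial.X : Polynomial K) • A.map Polynomial.C +
      B.map Polynomial.C)) = (t • A + B).det := by
  rw [← Polynomial.coe_evalRingHom, RingHom.map_det]
  congr 1
  ext i j
  simp; ring

/-! ### Infinite fields: the linear part scales the determinant -/

section AffineDet

variable {n : ℕ} {K : Type*} [Field K]
  {w : Matrix (Fin n) (Fin n) K →ₗ[K] Matrix (Fin n) (Fin n) K} {b : Matrix (Fin n) (Fin n) K}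

/-- Let `M ↦ w M + b` map singular matrices to singular matrices. Then its determinant on
`A E`, with `E` diagonalizable with distinct eigenvalues, is `det (w A) * det E`. -/
theorem det_affine_mul_diagonalizable (h : ∀ M, M.det = 0 → (w M + b).det = 0)
    (A : Matrix (Fin n) (Fin n) K) (Q : (Matrix (Fin n) (Fin n) K)ˣ) {e : Fin n → K}
    (he : Function.Injective e) :
    (w (A * ((Q : Matrix (Fin n) (Fin n) K) * diagonal e *
      ((Q⁻¹ : (Matrix (Fin n) (Fin n) K)ˣ) : Matrix (Fin n) (Fin n) K))) + b).det =
      (w A).det * ∏ i, e i := by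
  set E : (Fin n → K) → Matrix (Fin n) (Fin n) K := fun e =>
    (Q : Matrix (Fin n) (Fin n) K) * diagonal e *
      ((Q⁻¹ : (Matrix (Fin n) (Fin n) K)ˣ) : Matrix (Fin n) (Fin n) K) with hE
  have hE1 : ∀ t : K, E (fun i => e i + t) = E e + t • 1 := by
    intro t
    have : diagonal (fun i => e i + t) = diagonal e + t • (1 : Matrix (Fin n) (Fin n) K) := by
      rw [smul_one_eq_diagonal, diagonal_add]
    simp only [hE, this]
    rw [Matrix.mul_add, Matrix.add_mul, Matrix.mul_smul, Matrix.smul_mul, Matrix.mul_one,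
      Units.mul_inv]
  have hdet : ∀ e, (E e).det = ∏ i, e i := by
    intro e
    simp only [hE]
    rw [det_mul_right_comm, Units.mul_inv, Matrix.one_mul, det_diagonal]
  let p := det ((Polynomial.X : Polynomial K) • (w A).map Polynomial.C +
      (w (A * E e) + b).map Polynomial.C)
  let r : Polynomial K := ∏ i, (Polynomial.X + Polynomial.C (e i))
  have hr : r.Monic := Polynomial.monic_prod_of_monic _ _ fun i _ => Polynomial.monic_X_add_C _
  have hrn : r.natDegree = n := by
    rw [Polynomial.natDegree_prod_of_monic _ _ fun i _ => Polynomial.monic_X_add_C _]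
    simp
  -- Shifting the eigenvalues by `t` gives `p.eval t`, so `p` vanishes at the `n` distinct points
  -- `-e i`; its coefficient of degree `n` is `det (w A)`.
  have hpr : p = Polynomial.C (w A).det * r := by
    refine Polynomial.eq_of_degree_sub_lt_of_eval_index_eq (s := Finset.univ)
      (v := fun i => - e i) (fun i _ j _ hij => he (neg_injective hij)) ?_ ?_
    · rw [Polynomial.degree_lt_iff_coeff_zero]
      intro m hm
      simp only [Finset.card_univ, Fintype.card_fin] at hm
      rw [Polynomial.coeff_sub, Polynomial.coeff_C_mul]
      rcases hm.eq_or_lt with rfl | hm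
      · have h1 := Polynomial.coeff_det_X_add_C_card (w A) (w (A * E e) + b)
        rw [Fintype.card_fin] at h1
        have h2 : r.coeff n = 1 := by rw [← hr.coeff_natDegree, hrn]
        rw [h2, mul_one]
        exact sub_eq_zero.2 h1
      · have h1 := Polynomial.natDegree_det_X_add_C_le (w A) (w (A * E e) + b)
        rw [Fintype.card_fin] at h1
        rw [Polynomial.coeff_eq_zero_of_natDegree_lt (h1.trans_lt hm),
          Polynomial.coeff_eq_zero_of_natDegree_lt (by rwa [hrn]), mul_zero, sub_zero]
    · intro i _
      have h1 : p.eval (-e i) = (w (A * E (fun j => e j + -e i)) + b).det := by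
        rw [hE1, Matrix.mul_add, Matrix.mul_smul, Matrix.mul_one, map_add, map_smul]
        refine (eval_det_X_smul_add _ _ _).trans ?_
        congr 1
        abel
      rw [h1, h]
      · simp only [r, Polynomial.eval_mul, Polynomial.eval_C, Polynomial.eval_prod,
          Polynomial.eval_add, Polynomial.eval_X]
        rw [Finset.prod_eq_zero (Finset.mem_univ i) (by ring), mul_zero]
      · rw [det_mul, hdet, Finset.prod_eq_zero (Finset.mem_univ i) (by ring), mul_zero]
  have h0 := eval_det_X_smul_add (w A) (w (A * E e) + b) 0
  rw [zero_smul, zero_add] at h0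
  rw [← h0]
  change p.eval 0 = _
  rw [hpr]
  simp [r, Polynomial.eval_prod]

/-- Scaling the eigenvalues by `s` and comparing coefficients of `s ^ n` removes the translation
`b`. -/
theorem det_linear_mul_diagonalizable [Infinite K] (h : ∀ M, M.det = 0 → (w M + b).det = 0)
    (A : Matrix (Fin n) (Fin n) K) (Q : (Matrix (Fin n) (Fin n) K)ˣ) {e : Fin n → K}
    (he : Function.Injective e) :
    (w (A * ((Q : Matrix (Fin n) (Fin n) K) * diagonal e *
      ((Q⁻¹ : (Matrix (Fin n) (Fin n) K)ˣ) : Matrix (Fin n) (Fin n) K)))).det =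
      (w A).det * ∏ i, e i := by
  set N := w (A * ((Q : Matrix (Fin n) (Fin n) K) * diagonal e *
      ((Q⁻¹ : (Matrix (Fin n) (Fin n) K)ˣ) : Matrix (Fin n) (Fin n) K))) with hN
  have key : det ((Polynomial.X : Polynomial K) • N.map Polynomial.C + b.map Polynomial.C) =
      Polynomial.C ((w A).det * ∏ i, e i) * Polynomial.X ^ n := by
    refine Polynomial.eq_of_infinite_eval_eq _ _
      (Set.Infinite.mono ?_ (Set.Finite.infinite_compl (Set.finite_singleton (0 : K))))
    intro s hs
    have hs : s ≠ 0 := hs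
    have := det_affine_mul_diagonalizable h A Q (e := fun i => s * e i)
      fun i j hij => he (mul_left_cancel₀ hs hij)
    have hd : diagonal (fun i => s * e i) = s • diagonal e := by
      ext i j; by_cases hij : i = j <;> simp [hij, diagonal]
    rw [hd, Matrix.mul_smul, Matrix.smul_mul, Matrix.mul_smul, map_smul, ← hN] at this
    simp only [Set.mem_ofPred_eq]
    rw [eval_det_X_smul_add, this]
    simp [Finset.prod_mul_distrib, Polynomial.eval_prod]
    ring
  have h1 := Polynomial.coeff_det_X_add_C_card N b
  rw [key, Fintype.card_fin, Polynomial.coeff_C_mul, Polynomial.coeff_X_pow_self, mul_one] at h1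
  exact h1.symm

theorem det_linear_eq_zero [Infinite K] (h : ∀ M, M.det = 0 → (w M + b).det = 0)
    {A : Matrix (Fin n) (Fin n) K} (hA : A.det = 0) : (w A).det = 0 := by
  have key : det ((Polynomial.X : Polynomial K) • (w A).map Polynomial.C +
      b.map Polynomial.C) = 0 := by
    refine Polynomial.funext fun s => ?_
    rw [eval_det_X_smul_add, ← map_smul, h _ (by rw [det_smul, hA, mul_zero]),
      Polynomial.eval_zero]
  have h1 := Polynomial.coeff_det_X_add_C_card (w A) b
  rw [key, Polynomial.coeff_zero] at h1
  exact h1.symm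

theorem exists_forall_eval_ne_zero {ι : Type*} [Fintype ι] [Infinite K] (f : ι → Polynomial K)
    (hf : ∀ i, f i ≠ 0) : ∃ s, ∀ i, (f i).eval s ≠ 0 := by
  by_contra! H
  refine Finset.prod_ne_zero_iff.2 (fun i (_ : i ∈ Finset.univ) => hf i)
    (Polynomial.funext fun s => ?_)
  obtain ⟨i, hi⟩ := H s
  rw [Polynomial.eval_prod, Polynomial.eval_zero, Finset.prod_eq_zero (Finset.mem_univ i) hi]

/-- Powers `s ^ i` of a generic `s` work: each forbidden coincidence is a nonzero polynomial
condition on `s`. This factors an invertible diagonal matrix into two with distinct entries. -/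
theorem exists_injective_and_div_injective [Infinite K] {d : Fin n → K} (hd : ∀ i, d i ≠ 0) :
    ∃ e : Fin n → K, (∀ i, e i ≠ 0) ∧ Function.Injective e ∧
      Function.Injective fun i => d i / e i := by
  have aux : ∀ (d : Fin n → K), (∀ i, d i ≠ 0) → ∀ i j : Fin n, i ≠ j →
      Polynomial.C (d i) * Polynomial.X ^ (j : ℕ) -
        Polynomial.C (d j) * Polynomial.X ^ (i : ℕ) ≠ 0 := by
    intro d hd i j hij h
    have := congrArg (fun p => Polynomial.coeff p (j : ℕ)) h
    simp [Polynomial.coeff_X_pow, Fin.val_inj, hij.symm, hd] at this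
  obtain ⟨s, hs⟩ := exists_forall_eval_ne_zero (K := K)
    (fun p : {p : Fin n × Fin n // p.1 ≠ p.2} => Polynomial.X *
      (Polynomial.C 1 * Polynomial.X ^ (p.1.2 : ℕ) -
        Polynomial.C 1 * Polynomial.X ^ (p.1.1 : ℕ)) *
      (Polynomial.C (d p.1.1) * Polynomial.X ^ (p.1.2 : ℕ) -
        Polynomial.C (d p.1.2) * Polynomial.X ^ (p.1.1 : ℕ)))
    (fun p => mul_ne_zero (mul_ne_zero Polynomial.X_ne_zero
      (aux (fun _ => 1) (fun _ => one_ne_zero) _ _ p.2)) (aux d hd _ _ p.2))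
  rcases Nat.lt_or_ge n 2 with hn | hn
  · have : Subsingleton (Fin n) := Fin.subsingleton_iff_le_one.2 (by omega)
    exact ⟨1, fun _ => one_ne_zero, Function.injective_of_subsingleton _,
      Function.injective_of_subsingleton _⟩
  have hs' : ∀ i j : Fin n, i ≠ j → s ≠ 0 ∧ s ^ (j : ℕ) - s ^ (i : ℕ) ≠ 0 ∧
      d i * s ^ (j : ℕ) - d j * s ^ (i : ℕ) ≠ 0 := by
    intro i j hij
    have := hs ⟨(i, j), hij⟩
    simpa [not_or, and_assoc] using this
  have s0 : s ≠ 0 := (hs' ⟨0, by omega⟩ ⟨1, by omega⟩ (by simp)).1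
  refine ⟨fun i => s ^ (i : ℕ), fun i => pow_ne_zero _ s0, fun i j hij => ?_, fun i j hij => ?_⟩
  · by_contra hne
    exact (hs' i j hne).2.1 (sub_eq_zero.2 hij.symm)
  · by_contra hne
    refine (hs' i j hne).2.2 (sub_eq_zero.2 ?_)
    exact (div_eq_div_iff (pow_ne_zero _ s0) (pow_ne_zero _ s0)).1 hij

theorem det_linear_mul_diagonal [Infinite K] (h : ∀ M, M.det = 0 → (w M + b).det = 0)
    (A : Matrix (Fin n) (Fin n) K) {e : Fin n → K} (he : Function.Injective e) :
    (w (A * diagonal e)).det = (w A).det * ∏ i, e i := by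
  simpa using det_linear_mul_diagonalizable h A 1 he

theorem det_linear_mul_transvection [Infinite K] (h : ∀ M, M.det = 0 → (w M + b).det = 0)
    (A : Matrix (Fin n) (Fin n) K) {i j : Fin n} (hij : i ≠ j) (c : K) :
    (w (A * transvection i j c)).det = (w A).det := by
  obtain ⟨e, he0, he, he'⟩ := exists_injective_and_div_injective (K := K) (d := fun _ : Fin n => 1)
    fun _ => one_ne_zero
  simp only [one_div] at he'
  have hne : e j - e i ≠ 0 := sub_ne_zero.2 fun h => hij (he h).symm
  -- Solves `c' - c' * e i / e j = c`, which makes the transvection a conjugate of `diagonal e`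
  -- times the inverse of `diagonal e`.
  let c' := c * e j / (e j - e i)
  let Q : (Matrix (Fin n) (Fin n) K)ˣ := ⟨transvection i j c', transvection i j (-c'),
    by rw [transvection_mul_transvection_same _ _ hij]; simp,
    by rw [transvection_mul_transvection_same _ _ hij]; simp⟩
  have hT : transvection i j c = (transvection i j c' * diagonal e * transvection i j (-c')) *
      diagonal (fun i => (e i)⁻¹) := by
    have h1 : diagonal e * transvection i j (-c') * diagonal (fun i => (e i)⁻¹) =
        transvection i j (-c' * e i / e j) := by
      ext k l
      simp only [transvection, mul_diagonal, diagonal_mul, Matrix.add_apply, Matrix.single_apply,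
        Matrix.one_apply]
      by_cases hkl : k = l
      · subst hkl
        have : ¬ (i = k ∧ j = k) := fun h => hij (h.1.trans h.2.symm)
        simp [this, he0]
      · by_cases h2 : i = k ∧ j = l
        · obtain ⟨rfl, rfl⟩ := h2
          simp [hkl]
          field_simp
        · simp [hkl, h2]
    rw [Matrix.mul_assoc, Matrix.mul_assoc, ← Matrix.mul_assoc (diagonal e), h1,
      transvection_mul_transvection_same _ _ hij]
    congr 1
    simp only [c']
    have := he0 j
    field_simp
    ring
  have h2 := det_linear_mul_diagonalizable h A Q he
  have h3 := det_linear_mul_diagonal h (A * ((Q : Matrix (Fin n) (Fin n) K) * diagonal e *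
      ((Q⁻¹ : (Matrix (Fin n) (Fin n) K)ˣ) : Matrix (Fin n) (Fin n) K))) he'
  rw [hT, ← Matrix.mul_assoc]
  refine h3.trans ?_
  rw [h2, mul_assoc, ← Finset.prod_mul_distrib]
  simp [he0]

/-- Over an infinite field, the linear part of an affine map preserving singularity multiplies
the determinant by a constant. -/
theorem det_linear_eq_mul_det [Infinite K] (h : ∀ M, M.det = 0 → (w M + b).det = 0)
    (M : Matrix (Fin n) (Fin n) K) : (w M).det = (w 1).det * M.det := by
  by_cases hM : M.det = 0
  · rw [det_linear_eq_zero h hM, hM, mul_zero]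
  -- Quantifying over the left factor `A` makes the property stable under products.
  suffices H : ∀ A, (w (A * M)).det = (w A).det * M.det by simpa using H 1
  refine diagonal_transvection_induction_of_det_ne_zero
    (fun M => ∀ A, (w (A * M)).det = (w A).det * M.det) M hM ?_ ?_ ?_
  · intro d hd A
    rw [det_diagonal, Finset.prod_ne_zero_iff] at hd
    obtain ⟨e, he0, he, he'⟩ := exists_injective_and_div_injective fun i => hd i (Finset.mem_univ i)
    have : diagonal d = diagonal e * diagonal fun i => d i / e i := by
      rw [diagonal_mul_diagonal]
      congr 1
      ext i
      have := he0 i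
      field_simp
    rw [this, ← Matrix.mul_assoc, det_linear_mul_diagonal h _ he', det_linear_mul_diagonal h _ he,
      det_mul, det_diagonal, det_diagonal, mul_assoc]
  · intro t A
    rw [TransvectionStruct.det, mul_one]
    exact det_linear_mul_transvection h A t.hij t.c
  · intro A B _ _ hA hB C
    rw [← Matrix.mul_assoc, hB, hA, det_mul, mul_assoc]

theorem isDyad_of_det_eq_mul_det [Infinite K] (hw : Function.Surjective w) {c : K}
    (h : ∀ M, (w M).det = c * M.det) {A : Matrix (Fin n) (Fin n) K} (hA : IsDyad A) :
    IsDyad (w A) := by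
  by_contra H
  obtain ⟨P, Q, d, i, j, hd, hij, hi, hj⟩ := exists_diagonal_of_not_isDyad H
  obtain ⟨τ, hτ⟩ := exists_forall_eval_ne_zero (K := K) (ι := Unit)
    (fun _ => Polynomial.X * (Polynomial.X - 1)) (fun _ =>
      mul_ne_zero Polynomial.X_ne_zero (Polynomial.X_sub_C_ne_zero (1 : K)))
  have hτ : τ ≠ 0 ∧ τ - 1 ≠ 0 := by simpa [not_or] using hτ ()
  -- The determinant of `diagonal (f + t * d)` vanishes at `t = 0` through slot `i` and at `t = 1`
  -- through slot `j`, but not at `τ`, where the remaining entries equal `1`. No affine function of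
  -- `t` does this.
  let f : Fin n → K := fun k => if k = i then 0 else if k = j then - d j else 1 - τ * d k
  obtain ⟨B, hB⟩ := hw ((P : Matrix (Fin n) (Fin n) K) * diagonal f * Q)
  obtain ⟨α, β, hαβ⟩ := det_add_smul_isDyad hA B
  have key : ∀ t, c * (α + t * β) = P.val.det * Q.val.det * ∏ k, (f k + t * d k) := by
    intro t
    rw [← hαβ, ← h, map_add, map_smul, hB, hd, ← Matrix.smul_mul, ← Matrix.mul_smul,
      ← Matrix.add_mul, ← Matrix.mul_add, det_mul, det_mul]
    have : diagonal f + t • diagonal d = diagonal fun k => f k + t * d k := by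
      ext k l; by_cases hkl : k = l
      · subst hkl; simp
      · simp [hkl]
    rw [this, det_diagonal]
    ring
  have k0 := key 0
  have k1 := key 1
  have kτ := key τ
  rw [Finset.prod_eq_zero (Finset.mem_univ i) (by simp [f])] at k0
  rw [Finset.prod_eq_zero (Finset.mem_univ j) (by simp [f, hij.symm])] at k1
  have : c * (α + τ * β) = 0 := by linear_combination (1 - τ) * k0 + τ * k1
  rw [this, eq_comm, mul_eq_zero, mul_eq_zero] at kτ
  have hP : P.val.det ≠ 0 := ((isUnit_iff_isUnit_det _).1 P.isUnit).ne_zero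
  have hQ : Q.val.det ≠ 0 := ((isUnit_iff_isUnit_det _).1 Q.isUnit).ne_zero
  rcases kτ with (h | h) | h
  · exact hP h
  · exact hQ h
  · obtain ⟨k, -, hk⟩ := Finset.prod_eq_zero_iff.1 h
    simp only [f] at hk
    split_ifs at hk with h1 h2
    · subst h1
      simp [hτ.1, hi] at hk
    · subst h2
      have : (τ - 1) * d k = 0 := by linear_combination hk
      exact (mul_ne_zero hτ.2 hj) this
    · simp at hk

end AffineDet

/-! ### Finite fields: Fourier coefficients of the indicator of `GL_n` -/

section CharacterSums

variable {K : Type*} [Field K]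

/-- The determinant as a linear form of the first row. -/
noncomputable def detFirstRow {m : ℕ} (R : Fin m → Fin (m + 1) → K) :
    (Fin (m + 1) → K) →ₗ[K] K where
  toFun x := (Matrix.of (Fin.cons x R : Fin (m + 1) → Fin (m + 1) → K)).det
  map_add' x y := by
    simp only [det_succ_row_zero, ← Finset.sum_add_distrib]
    refine Finset.sum_congr rfl fun j _ => ?_
    simp [submatrix, Fin.cons_succ]
    ring
  map_smul' c x := by
    simp only [det_succ_row_zero, Finset.smul_sum]
    refine Finset.sum_congr rfl fun j _ => ?_
    simp [submatrix, Fin.cons_succ]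
    ring

/-- The form vanishes at each row of `R`, which forces the column `0` of `R` to vanish; the converse
is expansion along that column. -/
theorem detFirstRow_eq_iff {m : ℕ} (R : Fin m → Fin (m + 1) → K) :
    (∃ a ≠ 0, ∀ x, detFirstRow R x = a * x 0) ↔
      (∀ i, R i 0 = 0) ∧ (Matrix.of fun i j : Fin m => R i j.succ).det ≠ 0 := by
  have e0 : detFirstRow R (Pi.single 0 1) = (Matrix.of fun i j : Fin m => R i j.succ).det := by
    simp only [detFirstRow, LinearMap.coe_mk, AddHom.coe_mk]
    rw [det_succ_row_zero, Finset.sum_eq_single 0]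
    · simp only [Fin.val_zero, pow_zero, of_apply, Fin.cons_zero, Pi.single_eq_same, mul_one,
        one_mul]
      rfl
    · intro j _ hj
      simp [hj]
    · simp
  constructor
  · rintro ⟨a, ha, h⟩
    rw [← e0, h]
    refine ⟨fun i => ?_, by simpa using ha⟩
    have h1 : detFirstRow R (R i) = 0 := by
      simp only [detFirstRow, LinearMap.coe_mk, AddHom.coe_mk]
      exact det_zero_of_row_eq (i := 0) (j := i.succ) (Fin.succ_ne_zero i).symm rfl
    rw [h] at h1
    exact (mul_eq_zero.1 h1).resolve_left ha
  · rintro ⟨h0, h1⟩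
    refine ⟨_, h1, fun x => ?_⟩
    simp only [detFirstRow, LinearMap.coe_mk, AddHom.coe_mk]
    rw [det_succ_column_zero, Fin.sum_univ_succ, Finset.sum_eq_zero]
    · simp only [Fin.val_zero, pow_zero, of_apply, Fin.cons_zero, one_mul, add_zero]
      rw [mul_comm]
      rfl
    · intro i _
      simp [h0]

variable [Fintype K]

open scoped Classical in
/-- The Fourier coefficient at `N` of the indicator function of the non-singular matrices. -/
noncomputable def glCharSum (ψ : AddChar K ℂ) {n : ℕ} (N : Matrix (Fin n) (Fin n) K) : ℂ :=
  ∑ M : Matrix (Fin n) (Fin n) K, if M.det ≠ 0 then ψ (N * M).trace else 0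

theorem glCharSum_mul_mul (ψ : AddChar K ℂ) {n : ℕ} (P Q : (Matrix (Fin n) (Fin n) K)ˣ)
    (N : Matrix (Fin n) (Fin n) K) :
    glCharSum ψ ((P : Matrix (Fin n) (Fin n) K) * N * (Q : Matrix (Fin n) (Fin n) K)) =
      glCharSum ψ N := by
  have hP : P.val.det ≠ 0 := ((isUnit_iff_isUnit_det _).1 P.isUnit).ne_zero
  have hQ : Q.val.det ≠ 0 := ((isUnit_iff_isUnit_det _).1 Q.isUnit).ne_zero
  classical
  refine Fintype.sum_equiv (frobeniusU Q P).toEquiv _ _ fun M => ?_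
  have h1 : (frobeniusU Q P).toEquiv M = Q.val * M * P.val := rfl
  have h2 : (P.val * N * Q.val * M).trace = (N * (Q.val * M * P.val)).trace := by
    rw [Matrix.mul_assoc, Matrix.mul_assoc, trace_mul_comm]
    simp only [Matrix.mul_assoc]
  rw [h1, ← h2]
  exact if_congr (by simp [det_mul, hP, hQ]) rfl rfl

theorem glCharSum_diagonal (ψ : AddChar K ℂ) {n : ℕ} (d : Fin n → K) (σ : Equiv.Perm (Fin n)) :
    glCharSum ψ (diagonal (d ∘ σ)) = glCharSum ψ (diagonal d) := by
  classical
  refine Fintype.sum_equiv (Matrix.reindex σ σ) _ _ fun M => ?_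
  have h1 : (diagonal (d ∘ σ) * M).trace = (diagonal d * Matrix.reindex σ σ M).trace := by
    simp only [Matrix.trace, diag_apply, diagonal_mul, reindex_apply, submatrix_apply]
    exact Fintype.sum_equiv σ _ _ fun i => by simp
  have h2 : (Matrix.reindex σ σ M).det = M.det := det_reindex_self σ M
  rw [h1]
  exact if_congr (by rw [h2]) rfl rfl

theorem sum_addChar_mul_eq_zero {ψ : AddChar K ℂ} (hψ : ψ ≠ 1) {c : K} (hc : c ≠ 0) :
    ∑ t, ψ (c * t) = 0 := by
  classical
  have := AddChar.sum_mulShift c (AddChar.IsPrimitive.of_ne_one hψ)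
  simpa [mul_comm, hc] using this

-- If `ℓ` is not a nonzero multiple of the coordinate `x 0`, its kernel contains a vector `s` with
-- `ψ (c * s 0) ≠ 1`, and translation by `s` kills the sum. Otherwise only a sum over nonzero
-- scalars remains, equal to `-1`, times the `q ^ m` choices of other coordinates.
open scoped Classical in
theorem sum_ne_zero_addChar {ψ : AddChar K ℂ} (hψ : ψ ≠ 1) {m : ℕ} {c : K} (hc : c ≠ 0)
    (ℓ : (Fin (m + 1) → K) →ₗ[K] K) :
    (∑ x : Fin (m + 1) → K, if ℓ x ≠ 0 then ψ (c * x 0) else 0) =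
      if ∃ a ≠ 0, ∀ x, ℓ x = a * x 0 then -(Fintype.card K : ℂ) ^ m else 0 := by
  split_ifs with h
  · obtain ⟨a, ha, h⟩ := h
    simp only [h, Ne, mul_eq_zero, ha, false_or]
    rw [← (Fin.consEquiv fun _ : Fin (m + 1) => K).sum_comp, Fintype.sum_prod_type_right]
    simp only [Fin.consEquiv_apply, Fin.cons_zero, Finset.sum_const, Finset.card_univ,
      Fintype.card_fun, Fintype.card_fin, nsmul_eq_mul, Nat.cast_pow]
    have h1 : (∑ t : K, if ¬ t = 0 then ψ (c * t) else 0) = -1 := by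
      have h2 := sum_addChar_mul_eq_zero hψ hc
      have h3 : ∀ t : K, (if ¬ t = 0 then ψ (c * t) else 0) =
          ψ (c * t) - if t = 0 then 1 else 0 := by
        intro t
        by_cases ht : t = 0 <;> simp [ht]
      simp only [h3, Finset.sum_sub_distrib, h2]
      simp
    rw [h1]
    ring
  · have hz : ∃ z, ℓ z = 0 ∧ z 0 ≠ 0 := by
      by_contra! H
      have ha : ℓ (Pi.single 0 1) ≠ 0 := fun e => by simpa using H _ e
      refine h ⟨_, ha, fun x => ?_⟩
      have := H (x - (ℓ x / ℓ (Pi.single 0 1)) • Pi.single 0 1) (by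
        rw [map_sub, map_smul, smul_eq_mul, div_mul_cancel₀ _ ha, sub_self])
      simp only [Pi.sub_apply, Pi.smul_apply, Pi.single_eq_same, smul_eq_mul, mul_one] at this
      rw [sub_eq_zero.1 this, mul_div_cancel₀ _ ha]
    obtain ⟨z, hz, hz0⟩ := hz
    obtain ⟨t, ht⟩ := AddChar.ne_one_iff.1 hψ
    set s := (t / (c * z 0)) • z with hs
    have hs0 : ℓ s = 0 := by rw [hs, map_smul, hz, smul_zero]
    have hs1 : c * s 0 = t := by simp only [hs, Pi.smul_apply, smul_eq_mul]; field_simp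
    have key : (∑ x : Fin (m + 1) → K, if ℓ x ≠ 0 then ψ (c * x 0) else 0) =
        ψ t * ∑ x : Fin (m + 1) → K, if ℓ x ≠ 0 then ψ (c * x 0) else 0 := by
      rw [Finset.mul_sum]
      refine Fintype.sum_equiv (Equiv.addLeft (-s)) _ _ fun x => ?_
      rw [mul_ite, mul_zero, ← AddChar.map_add_eq_mul]
      refine if_congr (by simp [hs0]) ?_ rfl
      rw [← hs1, ← mul_add]
      simp
    have : (ψ t - 1) * ∑ x : Fin (m + 1) → K, (if ℓ x ≠ 0 then ψ (c * x 0) else 0) = 0 := by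
      rw [sub_mul, ← key, one_mul, sub_self]
    exact (mul_eq_zero.1 this).resolve_left (sub_ne_zero.2 ht)

/-- Summing over the first row first, only lower rows with zero first column and non-singular
remaining block contribute. -/
theorem glCharSum_diagonal_succ {ψ : AddChar K ℂ} (hψ : ψ ≠ 1) {m : ℕ} {d : Fin (m + 1) → K}
    (hd : d 0 ≠ 0) :
    glCharSum ψ (diagonal d) =
      -(Fintype.card K : ℂ) ^ m * glCharSum ψ (diagonal fun i => d i.succ) := by
  classical
  have step : glCharSum ψ (diagonal d) = ∑ R : Fin m → Fin (m + 1) → K,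
      ψ (∑ i, d i.succ * R i i.succ) * ∑ x : Fin (m + 1) → K,
        if detFirstRow R x ≠ 0 then ψ (d 0 * x 0) else 0 := by
    simp only [Finset.mul_sum]
    rw [glCharSum, ← Fintype.sum_prod_type_right']
    refine (Fintype.sum_equiv ((Fin.consEquiv fun _ : Fin (m + 1) => Fin (m + 1) → K).trans
      Matrix.of) _ _ fun p => ?_).symm
    have h1 : detFirstRow p.2 p.1 = (((Fin.consEquiv fun _ : Fin (m + 1) =>
      Fin (m + 1) → K).trans Matrix.of) p).det := rfl
    rw [h1, mul_ite, mul_zero, ← AddChar.map_add_eq_mul]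
    congr 2
    simp only [Matrix.trace, diag_apply, diagonal_mul, Fin.sum_univ_succ]
    simp [add_comm]
  rw [step]
  simp only [sum_ne_zero_addChar hψ hd, detFirstRow_eq_iff]
  rw [glCharSum, Finset.mul_sum]
  symm
  refine Fintype.sum_of_injective
    (fun (M : Matrix (Fin m) (Fin m) K) i => (Fin.cons 0 (M i) : Fin (m + 1) → K)) ?_ _ _ ?_ ?_
  · intro M N h
    ext i j
    simpa using congrFun (congrFun h i) j.succ
  · intro R hR
    rw [if_neg, mul_zero]
    rintro ⟨h, -⟩
    refine hR ⟨Matrix.of fun i j => R i j.succ, funext fun i => funext fun j => ?_⟩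
    refine Fin.cases ?_ (fun j => ?_) j
    · simp [h]
    · simp
  · intro M
    have h1 : (Matrix.of fun i j : Fin m => (Fin.cons 0 (M i) : Fin (m + 1) → K) j.succ) = M := by
      ext i j; simp
    have h2 : (∑ i, d i.succ * (Fin.cons 0 (M i) : Fin (m + 1) → K) i.succ) =
        (diagonal (fun i : Fin m => d i.succ) * M).trace := by
      simp [Matrix.trace, diagonal_mul]
    rw [h2, h1, mul_ite, mul_zero, mul_ite, mul_zero, mul_comm]
    exact if_congr (by simp) rfl rfl

theorem glCharSum_zero (ψ : AddChar K ℂ) (n : ℕ) :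
    glCharSum ψ (0 : Matrix (Fin n) (Fin n) K) = Nat.card (GL (Fin n) K) := by
  classical
  have e : GL (Fin n) K ≃ {M : Matrix (Fin n) (Fin n) K // M.det ≠ 0} :=
    { toFun := fun P => ⟨P.val, ((isUnit_iff_isUnit_det _).1 P.isUnit).ne_zero⟩
      invFun := fun M => GeneralLinearGroup.mkOfDetNeZero M.1 M.2
      left_inv := fun P => Units.ext rfl
      right_inv := fun M => rfl }
  rw [Nat.card_congr e, Nat.card_eq_fintype_card, Fintype.card_subtype, glCharSum,
    Finset.card_filter, Nat.cast_sum]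
  refine Finset.sum_congr rfl fun M _ => ?_
  by_cases hM : M.det = 0 <;> simp [hM]

theorem norm_glCharSum_le (ψ : AddChar K ℂ) {n : ℕ} (N : Matrix (Fin n) (Fin n) K) :
    ‖glCharSum ψ N‖ ≤ Nat.card (GL (Fin n) K) := by
  classical
  have h := congrArg norm (glCharSum_zero ψ n (K := K))
  rw [Complex.norm_natCast] at h
  rw [← h]
  have : glCharSum ψ (0 : Matrix (Fin n) (Fin n) K) =
      ((∑ M : Matrix (Fin n) (Fin n) K, if M.det ≠ 0 then 1 else 0 : ℝ) : ℂ) := by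
    rw [glCharSum, Complex.ofReal_sum]
    refine Finset.sum_congr rfl fun M _ => ?_
    by_cases hM : M.det = 0 <;> simp [hM]
  rw [this, Complex.norm_of_nonneg (Finset.sum_nonneg fun M _ => by split_ifs <;> simp)]
  refine (norm_sum_le _ _).trans (Finset.sum_le_sum fun M _ => ?_)
  split_ifs <;> simp [ψ.norm_apply]

theorem card_GL_succ (m : ℕ) : Nat.card (GL (Fin (m + 1)) K) =
    (Fintype.card K ^ (m + 1) - 1) * Fintype.card K ^ m * Nat.card (GL (Fin m) K) := by
  rw [Matrix.card_GL_field, Matrix.card_GL_field, Fin.prod_univ_succ]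
  simp only [Fin.val_zero, pow_zero, Fin.val_succ, pow_succ']
  simp only [← Nat.mul_sub, Finset.prod_mul_distrib, Finset.prod_const, Finset.card_univ,
    Fintype.card_fin, mul_assoc]

theorem norm_glCharSum_diagonal {ψ : AddChar K ℂ} (hψ : ψ ≠ 1) {m : ℕ} {d : Fin (m + 1) → K}
    {i : Fin (m + 1)} (hd : d i ≠ 0) :
    ‖glCharSum ψ (diagonal d)‖ = (Fintype.card K : ℝ) ^ m *
      ‖glCharSum ψ (diagonal fun k : Fin m => d (Equiv.swap 0 i k.succ))‖ := by
  rw [← glCharSum_diagonal ψ d (Equiv.swap 0 i), glCharSum_diagonal_succ hψ (by simpa using hd)]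
  simp

/-- The Fourier coefficients at the matrices of rank one have a larger absolute value than those
at the matrices of larger rank. -/
theorem norm_glCharSum_lt {ψ : AddChar K ℂ} (hψ : ψ ≠ 1) {n : ℕ}
    (hn : 2 < n ∨ 2 < Fintype.card K) {A B : Matrix (Fin n) (Fin n) K} (hA : IsDyad A)
    (hA0 : A ≠ 0) (hB : ¬ IsDyad B) : ‖glCharSum ψ B‖ < ‖glCharSum ψ A‖ := by
  obtain ⟨P, Q, k, c, hc, rfl⟩ := exists_single_of_isDyad hA hA0
  obtain ⟨P', Q', d, i, j, rfl, hij, hi, hj⟩ := exists_diagonal_of_not_isDyad hB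
  rw [glCharSum_mul_mul, glCharSum_mul_mul]
  obtain ⟨m, rfl⟩ : ∃ m, n = m + 2 := ⟨n - 2, by omega⟩
  have hq : 1 < Fintype.card K := Fintype.one_lt_card
  have hq0 : (0 : ℝ) < Fintype.card K := by exact_mod_cast hq.trans' zero_lt_one
  rw [norm_glCharSum_diagonal hψ (d := Pi.single k c) (i := k) (by simpa using hc), norm_glCharSum_diagonal hψ hi]
  refine mul_lt_mul_of_pos_left ?_ (pow_pos hq0 _)
  have h0 : (fun l : Fin (m + 1) => (Pi.single k c : Fin (m + 2) → K)
      (Equiv.swap 0 k l.succ)) = 0 := by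
    funext l
    rw [Pi.zero_apply, Pi.single_eq_of_ne]
    intro h
    rw [Equiv.swap_apply_eq_iff, Equiv.swap_apply_right] at h
    exact Fin.succ_ne_zero l h
  rw [h0, diagonal_zero', glCharSum_zero, Complex.norm_natCast, card_GL_succ]
  obtain ⟨l, hl⟩ : ∃ l : Fin (m + 1), Equiv.swap 0 i l.succ = j := by
    have : Equiv.swap 0 i j ≠ 0 := by
      rw [Ne, Equiv.swap_apply_eq_iff, Equiv.swap_apply_left]
      exact hij.symm
    obtain ⟨l, hl⟩ := Fin.exists_succ_eq.2 this
    exact ⟨l, by rw [hl, Equiv.swap_apply_self]⟩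
  rw [norm_glCharSum_diagonal hψ (i := l) (by simpa only [hl] using hj)]
  refine (mul_le_mul_of_nonneg_left (norm_glCharSum_le ψ _) (pow_nonneg hq0.le _)).trans_lt ?_
  norm_cast
  rw [mul_assoc]
  refine lt_mul_of_one_lt_left (Nat.mul_pos (pow_pos (by omega) _) Nat.card_pos) ?_
  -- The two bounds differ by the factor `q ^ (m + 1) - 1`, with `m + 1 = n - 1`; it equals `1`
  -- exactly in the excluded case.
  have : 2 < Fintype.card K ^ (m + 1) := by
    rcases hn with hn | hn
    · obtain ⟨m, rfl⟩ : ∃ m', m = m' + 1 := ⟨m - 1, by omega⟩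
      calc 2 < 2 ^ 2 := by norm_num
        _ ≤ 2 ^ (m + 1 + 1) := Nat.pow_le_pow_right (by norm_num) (by omega)
        _ ≤ _ := Nat.pow_le_pow_left hq _
    · exact hn.trans_le (Nat.le_self_pow (by omega) _)
  omega

end CharacterSums

/-! ### Trace duality and the proof of (a) -/

theorem mem_glSet_iff {n : ℕ} {K : Type*} [Field K] {M : Matrix (Fin n) (Fin n) K} :
    M ∈ glSet n K ↔ M.det ≠ 0 := by
  rw [← isUnit_iff_ne_zero, ← isUnit_iff_isUnit_det]
  rfl

/-- The adjoint of a linear map for the bilinear form `(N, M) ↦ tr (N M)`. -/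
def traceAdjoint {n : ℕ} {K : Type*} [Field K]
    (w : Matrix (Fin n) (Fin n) K →ₗ[K] Matrix (Fin n) (Fin n) K) :
    Matrix (Fin n) (Fin n) K →ₗ[K] Matrix (Fin n) (Fin n) K where
  toFun N := Matrix.of fun i j => (N * w (Matrix.single j i 1)).trace
  map_add' A B := by ext; simp [Matrix.add_mul]
  map_smul' c A := by ext; simp

theorem trace_traceAdjoint_mul {n : ℕ} {K : Type*} [Field K]
    (w : Matrix (Fin n) (Fin n) K →ₗ[K] Matrix (Fin n) (Fin n) K)
    (N M : Matrix (Fin n) (Fin n) K) : (traceAdjoint w N * M).trace = (N * w M).trace := by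
  have : traceLinearMap (Fin n) K K ∘ₗ LinearMap.mulLeft K (traceAdjoint w N) =
      traceLinearMap (Fin n) K K ∘ₗ LinearMap.mulLeft K N ∘ₗ w := by
    refine Matrix.ext_linearMap K fun i j => LinearMap.ext_ring ?_
    simp [traceAdjoint, trace_mul_single]
  exact LinearMap.congr_fun this M

theorem traceAdjoint_injective {n : ℕ} {K : Type*} [Field K]
    (w : Matrix (Fin n) (Fin n) K ≃ₗ[K] Matrix (Fin n) (Fin n) K) :
    Function.Injective (traceAdjoint w.toLinearMap) := by
  refine (injective_iff_map_eq_zero _).2 fun N hN => ext_iff_trace_mul_right.2 fun M => ?_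
  have := trace_traceAdjoint_mul w.toLinearMap N (w.symm M)
  rw [hN] at this
  simpa using this.symm

/-- If the adjoint of `w` belongs to the Frobenius group, then so does `w`. -/
theorem mem_frobeniusGroup_of_traceAdjoint {n : ℕ} {K : Type*} [Field K]
    (w w' : Matrix (Fin n) (Fin n) K ≃ₗ[K] Matrix (Fin n) (Fin n) K)
    (h : ∀ N M, (w' N * M).trace = (N * w M).trace) (hw' : w' ∈ frobeniusGroup n K) :
    w ∈ frobeniusGroup n K := by
  rcases hw' with ⟨P, Q, rfl⟩ | ⟨P, Q, rfl⟩
  · refine Or.inl ⟨Q, P, LinearEquiv.ext fun M => ext_iff_trace_mul_left.2 fun N => ?_⟩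
    rw [← h, frobeniusU_apply, frobeniusU_apply, Matrix.mul_assoc, Matrix.mul_assoc, trace_mul_comm]
    simp only [Matrix.mul_assoc]
  · refine Or.inr ⟨unitTranspose P, unitTranspose Q, LinearEquiv.ext fun M =>
      ext_iff_trace_mul_left.2 fun N => ?_⟩
    rw [← h, frobeniusV_apply, frobeniusV_apply, ← trace_transpose (N * _)]
    simp only [unitTranspose, transpose_mul, transpose_transpose, Matrix.mul_assoc]
    rw [trace_mul_comm]
    simp only [Matrix.mul_assoc]
    rw [trace_mul_comm]
    simp only [Matrix.mul_assoc]

theorem frobeniusGroup_det_eq_zero_iff {n : ℕ} {K : Type*} [Field K]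
    {f : Matrix (Fin n) (Fin n) K ≃ₗ[K] Matrix (Fin n) (Fin n) K} (hf : f ∈ frobeniusGroup n K)
    (M : Matrix (Fin n) (Fin n) K) : (f M).det = 0 ↔ M.det = 0 := by
  have hu : ∀ P : (Matrix (Fin n) (Fin n) K)ˣ, P.val.det ≠ 0 := fun P =>
    ((isUnit_iff_isUnit_det _).1 P.isUnit).ne_zero
  rcases hf with ⟨P, Q, rfl⟩ | ⟨P, Q, rfl⟩
  · simp [frobeniusU_apply, hu]
  · simp [frobeniusV_apply, hu]

/-- A translation that maps singular matrices to singular matrices is trivial. -/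
theorem eq_zero_of_translation {n : ℕ} {K : Type*} [Field K] {b : Matrix (Fin n) (Fin n) K}
    (h : ∀ M, M.det = 0 → (M + b).det = 0) : b = 0 := by
  by_contra hb
  obtain ⟨P, Q, d, rfl⟩ := exists_units_diagonal b
  have hd : ∃ i, d i ≠ 0 := by
    by_contra! H
    exact hb (by rw [funext H, ← Pi.zero_def, diagonal_zero', Matrix.mul_zero, Matrix.zero_mul])
  obtain ⟨i, hi⟩ := hd
  -- Ones exactly where `d` vanishes: `f` has a zero entry, while `f + d` has none.
  let f : Fin n → K := by
    classical exact fun k => if d k = 0 then 1 else 0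
  have h1 := h (P.val * diagonal f * Q.val) (by
    rw [det_mul, det_mul, det_diagonal,
      Finset.prod_eq_zero (Finset.mem_univ i) (by simp [f, hi]), mul_zero, zero_mul])
  rw [← Matrix.add_mul, ← Matrix.mul_add, diagonal_add, det_mul, det_mul, det_diagonal,
    mul_eq_zero, mul_eq_zero, or_iff_left
      ((isUnit_iff_isUnit_det _).1 Q.isUnit).ne_zero, or_iff_right
      ((isUnit_iff_isUnit_det _).1 P.isUnit).ne_zero, Finset.prod_eq_zero_iff] at h1
  obtain ⟨k, -, hk⟩ := h1
  by_cases h0 : d k = 0 <;> simp [f, h0] at hk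

theorem mem_frobeniusGroup_of_infinite {n : ℕ} {K : Type*} [Field K] [Infinite K]
    (w : Matrix (Fin n) (Fin n) K ≃ₗ[K] Matrix (Fin n) (Fin n) K) (b : Matrix (Fin n) (Fin n) K)
    (h : ∀ M, M.det = 0 → (w M + b).det = 0) : w ∈ frobeniusGroup n K :=
  mem_frobeniusGroup_of_isDyad w fun _ hM =>
    isDyad_of_det_eq_mul_det (w := w.toLinearMap) w.surjective
      (det_linear_eq_mul_det (w := w.toLinearMap) h) hM

theorem mem_frobeniusGroup_of_fintype {n : ℕ} {K : Type*} [Field K] [Fintype K]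
    (hn : 2 < n ∨ 2 < Fintype.card K)
    (w : Matrix (Fin n) (Fin n) K ≃ₗ[K] Matrix (Fin n) (Fin n) K) (b : Matrix (Fin n) (Fin n) K)
    (h : ∀ M, M.det = 0 → (w M + b).det = 0) : w ∈ frobeniusGroup n K := by
  classical
  let v : Matrix (Fin n) (Fin n) K ≃ Matrix (Fin n) (Fin n) K :=
    w.toEquiv.trans (Equiv.addRight b)
  have hv : ∀ M, v M = w M + b := fun _ => rfl
  -- An injective self-map of the finite set of singular matrices is onto.
  have hiff : ∀ M, (w M + b).det = 0 ↔ M.det = 0 := by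
    let S := {M : Matrix (Fin n) (Fin n) K // M.det = 0}
    let g : S → S := fun M => ⟨v M.1, h _ M.2⟩
    have hg : Function.Injective g := fun M N e =>
      Subtype.ext (v.injective (congrArg Subtype.val e))
    have hg' := Finite.surjective_of_injective hg
    intro M
    refine ⟨fun hM => ?_, h M⟩
    obtain ⟨N, hN⟩ := hg' ⟨v M, hM⟩
    rw [← v.injective (congrArg Subtype.val hN)]
    exact N.2
  let w' := LinearEquiv.ofInjectiveEndo _ (traceAdjoint_injective w)
  have hw' : ∀ N M, (w' N * M).trace = (N * w M).trace := trace_traceAdjoint_mul w.toLinearMap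
  refine mem_frobeniusGroup_of_traceAdjoint w w' hw' (mem_frobeniusGroup_of_isDyad w' ?_)
  obtain ⟨ψ, hψ⟩ := AddChar.exists_apply_ne_zero.2 (one_ne_zero (α := K))
  have hψ : ψ ≠ 1 := fun e => hψ (by rw [e, AddChar.one_apply])
  -- Substituting `v M` for the summation variable leaves only a phase from `b`.
  have key : ∀ N, glCharSum ψ N = ψ (N * b).trace * glCharSum ψ (w' N) := by
    intro N
    rw [glCharSum, glCharSum, Finset.mul_sum]
    refine (Fintype.sum_equiv v _ _ fun M => ?_).symm
    rw [mul_ite, mul_zero, ← AddChar.map_add_eq_mul, hw', hv]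
    refine if_congr (not_congr (hiff M).symm) ?_ rfl
    rw [Matrix.mul_add, trace_add, add_comm]
  have hnorm : ∀ N, ‖glCharSum ψ N‖ = ‖glCharSum ψ (w' N)‖ := fun N => by
    rw [key, norm_mul, ψ.norm_apply, one_mul]
  intro N hN
  by_cases h0 : N = 0
  · exact ⟨0, 0, by simp [h0]⟩
  by_contra H
  exact (norm_glCharSum_lt hψ hn hN h0 H).ne' (hnorm N)

theorem affine_singular_preserver {n : ℕ} {K : Type*} [Field K]
    (hn : 2 < n ∨ 2 < Cardinal.mk K)
    (v : Matrix (Fin n) (Fin n) K ≃ᵃ[K] Matrix (Fin n) (Fin n) K)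
    (h : ∀ M, M.det = 0 → (v M).det = 0) :
    v.linear ∈ frobeniusGroup n K ∧ ∀ M, v M = v.linear M := by
  have hv : ∀ M, v M = v.linear M + v 0 := fun M => by
    have := v.map_vadd 0 M
    simpa using this
  replace h : ∀ M, M.det = 0 → (v.linear M + v 0).det = 0 := fun M hM => hv M ▸ h M hM
  have hw : v.linear ∈ frobeniusGroup n K := by
    rcases finite_or_infinite K with hK | hK
    · have := Fintype.ofFinite K
      refine mem_frobeniusGroup_of_fintype (hn.imp id fun h => ?_) _ _ h
      rw [Cardinal.mk_fintype] at h
      exact_mod_cast h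
    · exact mem_frobeniusGroup_of_infinite _ _ h
  refine ⟨hw, fun M => ?_⟩
  have h0 : v 0 = 0 := eq_zero_of_translation fun M hM => by
    have := h (v.linear.symm M) ((frobeniusGroup_det_eq_zero_iff hw _).1 (by simpa using hM))
    simpa using this
  rw [hv M, h0, add_zero]

theorem linearToAffine_mem_affineStabilizer {n : ℕ} {K : Type*} [Field K]
    {f : Matrix (Fin n) (Fin n) K ≃ₗ[K] Matrix (Fin n) (Fin n) K} (hf : f ∈ frobeniusGroup n K) :
    linearToAffine K _ f ∈ affineStabilizer n K := by
  change f '' glSet n K = glSet n K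
  ext M
  refine ⟨?_, fun hM => ⟨f.symm M, ?_, by simp⟩⟩
  · rintro ⟨M, hM, rfl⟩
    rw [mem_glSet_iff] at hM ⊢
    rwa [Ne, frobeniusGroup_det_eq_zero_iff hf]
  · rw [mem_glSet_iff] at hM ⊢
    rwa [Ne, ← frobeniusGroup_det_eq_zero_iff hf, LinearEquiv.apply_symm_apply]

theorem exists_frobenius_of_mapsTo {n : ℕ} {K : Type*} [Field K]
    (hn : 2 < n ∨ 2 < Cardinal.mk K)
    (u : Matrix (Fin n) (Fin n) K ≃ᵃ[K] Matrix (Fin n) (Fin n) K)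
    (hu : Set.MapsTo u (glSet n K) (glSet n K)) :
    ∃ f ∈ frobeniusGroup n K, linearToAffine K _ f = u := by
  obtain ⟨hw, h⟩ := affine_singular_preserver hn u.symm fun M hM => by
    by_contra H
    have := hu (mem_glSet_iff.2 H)
    rw [AffineEquiv.apply_symm_apply, mem_glSet_iff] at this
    exact this hM
  refine ⟨u.symm.linear⁻¹, inv_mem hw, ?_⟩
  ext1 M
  obtain ⟨N, rfl⟩ := u.symm.surjective M
  rw [AffineEquiv.apply_symm_apply, h]
  exact u.symm.linear.symm_apply_apply N

theorem apply_mem_glSet_iff {n : ℕ} {K : Type*} [Field K]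
    {u : Matrix (Fin n) (Fin n) K ≃ᵃ[K] Matrix (Fin n) (Fin n) K} (hu : u ∈ affineStabilizer n K)
    (M : Matrix (Fin n) (Fin n) K) : u M ∈ glSet n K ↔ M ∈ glSet n K := by
  have hu : u '' glSet n K = glSet n K := hu
  conv_lhs => rw [← hu]
  exact u.injective.mem_set_image

/-! ### The exceptional case: 2 × 2 matrices over `𝔽₂` -/

/-- The action of the affine stabilizer on the set of non-singular matrices. -/
def restrictGL (n : ℕ) (K : Type*) [Field K] : affineStabilizer n K →* Equiv.Perm (glSet n K) where
  toFun u := u.1.toEquiv.subtypeEquiv fun M => (apply_mem_glSet_iff u.2 M).symm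
  map_one' := rfl
  map_mul' _ _ := rfl

local notation "M₂" => Matrix (Fin 2) (Fin 2) (ZMod 2)

theorem mem_glSet_two_iff {M : M₂} : M ∈ glSet 2 (ZMod 2) ↔ M.det = 1 := by
  rw [mem_glSet_iff]
  generalize M.det = t
  revert t
  decide

theorem mem_affineStabilizer_two_iff {u : M₂ ≃ᵃ[ZMod 2] M₂} :
    u ∈ affineStabilizer 2 (ZMod 2) ↔ ∀ M, (u M).det = M.det := by
  constructor
  · intro hu M
    have h := apply_mem_glSet_iff hu M
    rw [mem_glSet_two_iff, mem_glSet_two_iff] at h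
    generalize (u M).det = s at h ⊢
    generalize M.det = t at h ⊢
    revert s t
    decide
  · intro h
    change u '' glSet 2 (ZMod 2) = glSet 2 (ZMod 2)
    ext M
    refine ⟨?_, fun hM => ⟨u.symm M, ?_, by simp⟩⟩
    · rintro ⟨M, hM, rfl⟩
      rwa [mem_glSet_two_iff, h, ← mem_glSet_two_iff]
    · rwa [mem_glSet_two_iff, ← h, AffineEquiv.apply_symm_apply, ← mem_glSet_two_iff]

theorem detPolarForm_apply (A B : M₂) : detPolarForm A B = (A + B).det - A.det - B.det := rfl

theorem det_add_eq (A B : M₂) : (A + B).det = A.det + B.det + detPolarForm A B := by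
  rw [detPolarForm_apply]; ring

theorem add_self_zmod_two {V : Type*} [AddCommGroup V] [Module (ZMod 2) V] (x : V) :
    x + x = 0 := by
  rw [← two_smul (ZMod 2) x, show (2 : ZMod 2) = 0 from rfl, zero_smul]

theorem detPolarForm_isAlt : detPolarForm.IsAlt := fun A => by
  rw [detPolarForm_apply, add_self_zmod_two, det_zero, sub_sub, zero_sub,
    add_self_zmod_two, neg_zero]

theorem detPolarForm_nondegenerate : detPolarForm.Nondegenerate := by
  have h : ∀ A : M₂, (∀ B : M₂, (A + B).det - A.det - B.det = 0) → A = 0 := by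
    decide +kernel
  refine ⟨h, fun A hA => h A fun B => ?_⟩
  rw [← hA B, detPolarForm_apply, add_comm A B]
  ring

theorem card_det_eq_one : Fintype.card {M : M₂ // M.det = 1} = 6 := by
  decide +kernel

theorem natCard_glSet_two : Nat.card (glSet 2 (ZMod 2)) = 6 := by
  have e : glSet 2 (ZMod 2) ≃ {M : M₂ // M.det = 1} :=
    Equiv.subtypeEquivRight fun M => mem_glSet_two_iff
  rw [Nat.card_congr e, Nat.card_eq_fintype_card, card_det_eq_one]

theorem card_det_eq_zero : Fintype.card {M : M₂ // M.det = 0} = 10 := by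
  decide +kernel

theorem det_add_add_eq_zero : ∀ A B C : M₂, A.det = 1 → B.det = 1 → C.det = 1 →
    A ≠ B → A ≠ C → B ≠ C → (A + B + C).det = 0 := by
  decide +kernel

/-- The orthogonal transvection along `D`, followed by the translation that makes it preserve
the determinant. -/
def affineTransvection (D : M₂) : M₂ ≃ᵃ[ZMod 2] M₂ where
  toEquiv := Function.Involutive.toPerm
    (fun M => M + (detPolarForm M D + (D.det + 1)) • D) fun M => by
      simp only [map_add, map_smul, LinearMap.add_apply, LinearMap.smul_apply,
        detPolarForm_isAlt D, smul_zero, add_zero]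
      rw [add_assoc, add_self_zmod_two, add_zero]
  linear := LinearEquiv.ofInvolutive (σ := RingHom.id (ZMod 2)) (σ' := RingHom.id (ZMod 2))
    (LinearMap.id + (detPolarForm.flip D).smulRight D) fun M => by
      change M + detPolarForm M D • D + detPolarForm (M + detPolarForm M D • D) D • D = M
      simp only [map_add, map_smul, LinearMap.add_apply, LinearMap.smul_apply,
        detPolarForm_isAlt D, smul_zero, add_zero]
      rw [add_assoc, add_self_zmod_two, add_zero]
  map_vadd' P V := by
    change V + P + (detPolarForm (V + P) D + (D.det + 1)) • D =
      V + detPolarForm V D • D + (P + (detPolarForm P D + (D.det + 1)) • D)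
    rw [map_add, LinearMap.add_apply]
    module

theorem affineTransvection_apply (D M : M₂) :
    affineTransvection D M = M + (detPolarForm M D + (D.det + 1)) • D := rfl

/-- With `λ = b(M, D) + det D + 1`, the determinant changes by `λ * (det D + b(M, D)) = λ * (λ + 1)
= 0`, since `λ ^ 2 = λ`. -/
theorem affineTransvection_mem (D : M₂) : affineTransvection D ∈ affineStabilizer 2 (ZMod 2) := by
  rw [mem_affineStabilizer_two_iff]
  intro M
  rw [affineTransvection_apply, det_add_eq, map_smul, det_smul, Fintype.card_fin, smul_eq_mul]
  generalize detPolarForm M D = b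
  generalize M.det = s
  generalize D.det = t
  revert b s t
  decide

/-- The coefficient of `A + B` is `1` at `A` and at `B`. At a third non-singular `M` it equals `det
(M + A + B)`, which is zero. -/
theorem restrictGL_affineTransvection {A B : M₂} (hA : A ∈ glSet 2 (ZMod 2))
    (hB : B ∈ glSet 2 (ZMod 2)) (hAB : A ≠ B) [DecidableEq (glSet 2 (ZMod 2))] :
    restrictGL 2 (ZMod 2) ⟨affineTransvection (A + B), affineTransvection_mem _⟩ =
      Equiv.swap ⟨A, hA⟩ ⟨B, hB⟩ := by
  ext1 ⟨M, hM⟩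
  refine Subtype.ext ?_
  change affineTransvection (A + B) M = _
  have hA' := mem_glSet_two_iff.1 hA
  have hB' := mem_glSet_two_iff.1 hB
  have hM' := mem_glSet_two_iff.1 hM
  have h2 : (1 + 1 : ZMod 2) = 0 := rfl
  have hD : (A + B).det = detPolarForm A B := by
    rw [det_add_eq, hA', hB', h2, zero_add]
  rw [affineTransvection_apply, hD, map_add]
  by_cases h1 : M = A
  · subst h1
    rw [Equiv.swap_apply_left, detPolarForm_isAlt, zero_add, ← add_assoc, add_self_zmod_two,
      zero_add, one_smul, ← add_assoc, add_self_zmod_two, zero_add]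
  by_cases h2 : M = B
  · subst h2
    have hsymm : detPolarForm M A = detPolarForm A M := by
      rw [detPolarForm_apply, detPolarForm_apply, add_comm]; ring
    rw [Equiv.swap_apply_right, detPolarForm_isAlt, add_zero, hsymm, ← add_assoc,
      add_self_zmod_two, zero_add, one_smul, add_comm A, ← add_assoc, add_self_zmod_two, zero_add]
  rw [Equiv.swap_apply_of_ne_of_ne (by simpa using h1) (by simpa using h2)]
  have h0 := det_add_add_eq_zero M A B hM' hA' hB' h1 h2 hAB
  have h3 : detPolarForm M A + detPolarForm M B + (detPolarForm A B + 1) = 0 := by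
    rw [← h0, det_add_eq, det_add_eq, hM', hA', hB', map_add, LinearMap.add_apply]
    generalize detPolarForm M A = r
    generalize detPolarForm M B = s
    generalize detPolarForm A B = t
    revert r s t
    decide
  rw [h3, zero_smul, add_zero]

theorem restrictGL_two_bijective : Function.Bijective (restrictGL 2 (ZMod 2)) := by
  classical
  constructor
  · rw [injective_iff_map_eq_one]
    rintro ⟨u, hu⟩ h
    have fix : ∀ M : M₂, M.det = 1 → u M = M := fun M hM =>
      congrArg Subtype.val (Equiv.congr_fun h ⟨M, mem_glSet_two_iff.2 hM⟩)
    have hlin : ∀ A B : M₂, A.det = 1 → B.det = 1 → u.linear (A - B) = A - B := by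
      intro A B hA hB
      have := u.toAffineMap.linearMap_vsub A B
      simpa [fix A hA, fix B hB] using this
    -- The non-singular matrices affinely span the space: every matrix unit is a difference of two
    -- of them.
    have hspan : ∀ i j : Fin 2, ∃ A B : M₂, A.det = 1 ∧ B.det = 1 ∧
        A - B = Matrix.single i j 1 := by
      decide +kernel
    have hl : u.linear.toLinearMap = LinearMap.id :=
      Matrix.ext_linearMap (ZMod 2) fun i j => LinearMap.ext_ring (by
        obtain ⟨A, B, hA, hB, e⟩ := hspan i j
        simpa [e] using hlin A B hA hB)
    refine Subtype.ext (AffineEquiv.ext fun M => ?_)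
    have h1 := u.toAffineMap.linearMap_vsub M 1
    have h2 := LinearMap.congr_fun hl (M - 1)
    have h3 := fix 1 det_one
    simp only [AffineEquiv.linear_toAffineMap, AffineEquiv.coe_toAffineMap, vsub_eq_sub, h3] at h1
    rw [h2] at h1
    simpa using h1.symm
  · rw [← MonoidHom.range_eq_top, eq_top_iff, ← Equiv.Perm.closure_isSwap, Subgroup.closure_le]
    rintro σ ⟨⟨A, hA⟩, ⟨B, hB⟩, hAB, rfl⟩
    refine ⟨_, restrictGL_affineTransvection hA hB fun e => hAB (Subtype.ext e)⟩

theorem linear_mem_formGroup {u : M₂ ≃ᵃ[ZMod 2] M₂} (hu : u ∈ affineStabilizer 2 (ZMod 2)) :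
    u.linear ∈ formGroup detPolarForm := by
  rw [mem_affineStabilizer_two_iff] at hu
  have hv : ∀ M, u M = u.linear M + u 0 := fun M => by
    have := u.map_vadd 0 M
    simpa using this
  intro A B
  have h0 := hu 0
  have hA := hu A
  have hB := hu B
  have hAB := hu (A + B)
  rw [hv] at hA hB hAB
  simp only [det_add_eq, map_add, LinearMap.add_apply, det_zero] at hA hB hAB h0
  linear_combination hAB - hA - hB + h0

/-- The linear part of an affine map that preserves the non-singular matrices. -/
def linearPart : affineStabilizer 2 (ZMod 2) →* formGroup detPolarForm :=
  (AffineEquiv.linearHom.comp (affineStabilizer 2 (ZMod 2)).subtype).codRestrict _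
    fun u => linear_mem_formGroup u.2

theorem linearPart_bijective : Function.Bijective linearPart := by
  constructor
  · rw [injective_iff_map_eq_one]
    rintro ⟨u, hu⟩ h
    have hl : u.linear = 1 := congrArg Subtype.val h
    have hv : ∀ M, u M = M + u 0 := fun M => by
      have := u.map_vadd 0 M
      simpa [hl] using this
    rw [mem_affineStabilizer_two_iff] at hu
    have h0 : u 0 = 0 := eq_zero_of_translation fun M hM => by rw [← hv, hu, hM]
    refine Subtype.ext (AffineEquiv.ext fun M => ?_)
    rw [hv, h0, add_zero]
    rfl
  · rintro ⟨f, hf⟩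
    have hf : ∀ A B, detPolarForm (f A) (f B) = detPolarForm A B := hf
    -- As `f` preserves the polar form, `det ∘ f` and `det` differ by an additive map, represented
    -- by some `c`; translating by `f c` corrects it up to the constant `det (f c)`.
    let l : M₂ →+ ZMod 2 :=
      { toFun := fun M => (f M).det + M.det
        map_zero' := by simp
        map_add' := fun A B => by
          rw [map_add, det_add_eq, det_add_eq, hf]
          linear_combination add_self_zmod_two (detPolarForm A B) }
    obtain ⟨c, hc⟩ := (detPolarForm.toDual detPolarForm_nondegenerate).surjective
      (l.toZModLinearMap 2)
    have hc : ∀ M, detPolarForm c M = (f M).det + M.det := fun M => by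
      have := LinearMap.congr_fun hc M
      rwa [LinearMap.BilinForm.toDual_def] at this
    let u : M₂ ≃ᵃ[ZMod 2] M₂ :=
      f.toAffineEquiv.trans (AffineEquiv.constVAdd (ZMod 2) M₂ (f c))
    have hu : ∀ M, (u M).det = M.det + (f c).det := by
      intro M
      have : u M = f c + f M := rfl
      rw [this, det_add_eq, hf, hc]
      linear_combination add_self_zmod_two (f M).det
    -- Were the constant `1`, `u` would exchange the ten singular and the six non-singular matrices.
    have h0 : (f c).det = 0 := by
      by_contra h1
      have h1 : (f c).det = 1 := by
        generalize (f c).det = t at h1 ⊢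
        revert t
        decide
      have e : {M : M₂ // M.det = 0} ≃ {M : M₂ // M.det = 1} :=
        u.toEquiv.subtypeEquiv fun M => by
          have := hu M
          rw [h1] at this
          change M.det = 0 ↔ (u M).det = 1
          rw [this]
          simp
      have := Fintype.card_congr e
      rw [card_det_eq_zero, card_det_eq_one] at this
      omega
    refine ⟨⟨u, mem_affineStabilizer_two_iff.2 fun M => by rw [hu, h0, add_zero]⟩, ?_⟩
    refine Subtype.ext (LinearEquiv.ext fun M => rfl)

theorem theorem3 :
    -- (a) the case `n > 2` or `|K| > 2`
    (∀ (n : ℕ) (K : Type*) [Field K], (2 < n ∨ 2 < Cardinal.mk K) →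
      (∀ u : Matrix (Fin n) (Fin n) K ≃ᵃ[K] Matrix (Fin n) (Fin n) K,
        Set.MapsTo u (glSet n K) (glSet n K) →
          u ∈ affineStabilizer n K ∧
          ∃ f : Matrix (Fin n) (Fin n) K ≃ₗ[K] Matrix (Fin n) (Fin n) K, ∀ M, u M = f M) ∧
      affineStabilizer n K =
        (frobeniusGroup n K).map (linearToAffine K (Matrix (Fin n) (Fin n) K))) ∧
    -- (b) a non-linear element
    (∃ u ∈ affineStabilizer 2 (ZMod 2),
      ¬ ∃ f : Matrix (Fin 2) (Fin 2) (ZMod 2) →ₗ[ZMod 2] Matrix (Fin 2) (Fin 2) (ZMod 2),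
        ∀ M, u M = f M) ∧
    -- (c) the action on the six non-singular matrices
    (∃ φ : affineStabilizer 2 (ZMod 2) ≃* Equiv.Perm (glSet 2 (ZMod 2)),
      ∀ (u : affineStabilizer 2 (ZMod 2)) (P : glSet 2 (ZMod 2)),
        ((φ u P : glSet 2 (ZMod 2)) : Matrix (Fin 2) (Fin 2) (ZMod 2)) =
          (u : Matrix (Fin 2) (Fin 2) (ZMod 2) ≃ᵃ[ZMod 2] Matrix (Fin 2) (Fin 2) (ZMod 2)) P) ∧
    Nat.card (glSet 2 (ZMod 2)) = 6 ∧
    Nonempty (Equiv.Perm (glSet 2 (ZMod 2)) ≃* Equiv.Perm (Fin 6)) ∧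
    -- (c) the linear part and the symplectic group of the polar form of the determinant
    detPolarForm.IsAlt ∧ detPolarForm.Nondegenerate ∧
    (∃ ψ : affineStabilizer 2 (ZMod 2) ≃* formGroup detPolarForm,
      ∀ u : affineStabilizer 2 (ZMod 2),
        (ψ u : Matrix (Fin 2) (Fin 2) (ZMod 2) ≃ₗ[ZMod 2] Matrix (Fin 2) (Fin 2) (ZMod 2)) =
          (u : Matrix (Fin 2) (Fin 2) (ZMod 2) ≃ᵃ[ZMod 2]
            Matrix (Fin 2) (Fin 2) (ZMod 2)).linear) := by
  refine ⟨?_, ?_, ⟨MulEquiv.ofBijective _ restrictGL_two_bijective, fun _ _ => rfl⟩,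
    natCard_glSet_two, ?_, detPolarForm_isAlt, detPolarForm_nondegenerate,
    ⟨MulEquiv.ofBijective _ linearPart_bijective, fun _ => rfl⟩⟩
  · intro n K _ hn
    have key : ∀ u : Matrix (Fin n) (Fin n) K ≃ᵃ[K] Matrix (Fin n) (Fin n) K,
        Set.MapsTo u (glSet n K) (glSet n K) →
          ∃ f ∈ frobeniusGroup n K, linearToAffine K _ f = u :=
      fun u hu => exists_frobenius_of_mapsTo hn u hu
    refine ⟨fun u hu => ?_, le_antisymm (fun u hu => ?_) ?_⟩
    · obtain ⟨f, hf, rfl⟩ := key u hu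
      exact ⟨linearToAffine_mem_affineStabilizer hf, f, fun _ => rfl⟩
    · exact key u fun M hM => (apply_mem_glSet_iff hu M).2 hM
    · rintro _ ⟨f, hf, rfl⟩
      exact linearToAffine_mem_affineStabilizer hf
  -- For a nonzero singular `D` the map sends `0` to `D`.
  · refine ⟨affineTransvection (Matrix.single 0 0 1), affineTransvection_mem _, ?_⟩
    rintro ⟨f, hf⟩
    have := hf 0
    rw [affineTransvection_apply, map_zero] at this
    have := congrFun (congrFun this 0) 0
    simp [Matrix.det_fin_two] at this
  · exact ⟨(Finite.equivFinOfCardEq natCard_glSet_two).permCongrHom⟩
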